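/- Let $\mathbb{Q}(q^{1/4})$ be the field of rational functions in $q^{1/4}$, and put $[k]=\frac{q^{k/2}-q^{-k/2}}{q^{1/2}-q^{-1/2}}$, $(q)_k=\prod_{l=1}^{k}(1-q^l)$ and, for non-negative integers with $n_1+\dots+n_r=n$, $\binom{n}{n_1,\dots,n_r}_q=\frac{(q)_n}{(q)_{n_1}\cdots(q)_{n_r}}$. For a disk with $N$ marked points on its boundary let $W_N$ be the $\mathbb{Q}(q^{1/4})$-vector space with basis the crossingless systems of arcs joining the marked points in pairs (up to isotopy fixing the boundary). Let $\langle\,\cdot\,\rangle_2$ be the Kauffman bracket, which sends a tangle diagram in the disk to an element of $W_N$ and is determined by the following rules: a crossing whose overstrand runs from the upper left to the lower right is $q^{1/4}$ times the smoothing that joins left ends to right ends by two horizontal arcs plus $q^{-1/4}$ times the smoothing $\supset\subset$; a crossing whose overstrand runs from the lower left to the upper right is $q^{1/4}$ times $\supset\subset$ plus $q^{-1/4}$ times the horizontal one; a closed loop is replaced by the factor $-[2]$. A strand of color $n$ is $n$ parallel strands. The clasp (Jones–Wenzl projector) $P_n$ of color $n$ is defined by: $P_0$ is empty, $P_1$ is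 one strand, and for $n\ge 2$ $$P_n=(P_{n-1}\sqcup 1)+\frac{[n-1]}{[n]}\,(P_{n-1}\sqcup 1)\,e_{n-1}\,(P_{n-1}\sqcup 1),$$ where $\sqcup 1$ adds one strand below and $e_{n-1}$ is the diagram $\supset\subset$ on the last two of $n$ strands together with $n-2$ straight strands. Diagrams containing clasps are evaluated by multilinearity. For non-negative integers $n,m$ let $\sigma_{n,m}$ be the diagram (read from left to right) of two strands of color $n$, one above the other, with a clasp of color $n$ at each of the two left ends and each of the two right ends, and between them $m$ consecutive right-handed half twists, i.e. $m$ crossings of the two colored strands in each of which the strand from the upper left to the lower right is over. For $0\le k\le n$ let $\beta_{n,k}$ be the crossingless diagram with the same four clasps in which the two upper clasps are joined by $k$ parallel strands, the two lower clasps by $k$ parallel strands, the two left clasps by $n-k$ parallel strands, and the two right clasps by $n-k$ parallel strands. **Proposition ($m$ half twists formula).** For all non-negative integers $n,m$, in $W_{4n}$, $$\langle\sigma_{n,m}\rangle_2=(-1)^{mn}q^{-\frac{m}{4}(n^2+2n)}\sum_{0\le k_m\le\dots\le k_1\le n}(-1)^{n-k_m}q^{\frac{n-k_m}{2}}(-1)^{\sum_{i=1}^{m}k_i}q^{\frac12\sum_{i=1}^{m}(k_i^2+k_i)}\binom{n}{k_1',k_2',\dots,k_m',k_m}_q\langle\beta_{n,k_m}\rangle_2,$$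 where $k_0=n$ and $k_{i+1}'=k_i-k_{i+1}$ for $i=0,1,\dots,m-1$. (For $m=0$ the sum has the single term with $k_m=k_0=n$.) -/

import Mathlib

noncomputable section

namespace KauffmanSkein

/-! ### The coefficient field, quantum integers and `q`-multinomial coefficients -/

/-- The field `ℚ(q^{1/4})` of rational functions in one variable `q^{1/4}`. -/
abbrev CoeffField : Type := RatFunc ℚ

/-- `qPow e` is `q^{e/4}`, a power of the variable `q^{1/4}` of the coefficient field. -/
def qPow (e : ℤ) : CoeffField := (RatFunc.X : RatFunc ℚ) ^ e

/-- The indeterminate `q = (q^{1/4})^4`. -/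
def q : CoeffField := qPow 4

/-- The quantum integer `[k] = (q^{k/2} - q^{-k/2}) / (q^{1/2} - q^{-1/2})`. -/
def quantumInt (k : ℤ) : CoeffField :=
  (qPow (2 * k) - qPow (-(2 * k))) / (qPow 2 - qPow (-2))

/-- The `q`-Pochhammer symbol `(q)_k = ∏_{l=1}^{k} (1 - q^l)`. -/
def qPochhammer (k : ℕ) : CoeffField := ∏ l ∈ Finset.Icc 1 k, (1 - q ^ l)

/-- The `q`-multinomial coefficient `(q)_n / ((q)_{n_1} ⋯ (q)_{n_r})`, where `ns = [n_1, …, n_r]`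
is a list of natural numbers with sum `n`. -/
def qMultinomial (n : ℕ) (ns : List ℕ) : CoeffField :=
  qPochhammer n / (ns.map qPochhammer).prod

/-! ### Basis webs and web spaces -/

/-- A basis web on a disk with `m` marked points `0, …, m - 1` in their order along the boundary
circle: a system of disjoint arcs joining the marked points in pairs, up to isotopy fixing the
boundary, i.e. a noncrossing perfect matching of the marked points. `partner x` is the other end of
the arc at `x`; numbers `x ≥ m` are not marked points and are sent to themselves. -/
@[ext]
structure BasisWeb (m : ℕ) where
  partner : ℕ → ℕ
  partner_of_le : ∀ x, m ≤ x → partner x = x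
  partner_lt : ∀ x, x < m → partner x < m
  partner_ne : ∀ x, x < m → partner x ≠ x
  partner_partner : ∀ x, partner (partner x) = x
  noncrossing : ∀ x y, ¬ (x < y ∧ y < partner x ∧ partner x < partner y)

/-- The web space `W_m`: the vector space over `ℚ(q^{1/4})` with basis the basis webs. -/
abbrev WebSpace (m : ℕ) : Type := BasisWeb m →₀ CoeffField

/-- The number of a marked point after two new marked points `i`, `i + 1` have been inserted. -/
def skipTwo (i x : ℕ) : ℕ := if x < i then x else x + 2

/-- The number of a marked point `x ≠ i, i + 1` after the points `i`, `i + 1` have been removed. -/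
def dropTwo (i x : ℕ) : ℕ := if x < i then x else x - 2

/-- The partner of `x ≠ i, i + 1` after the ends at `i` and `i + 1` have been joined. -/
def joinEnds (f : ℕ → ℕ) (i x : ℕ) : ℕ :=
  if f x = i then f (i + 1) else if f x = i + 1 then f i else f x

theorem dropTwo_skipTwo (i x : ℕ) : dropTwo i (skipTwo i x) = x := by
  grind [skipTwo, dropTwo]

theorem skipTwo_dropTwo (i x : ℕ) (h : x ≠ i) (h' : x ≠ i + 1) :
    skipTwo i (dropTwo i x) = x := by
  grind [skipTwo, dropTwo]

theorem skipTwo_ne (i x : ℕ) : skipTwo i x ≠ i ∧ skipTwo i x ≠ i + 1 := by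
  grind [skipTwo]

theorem skipTwo_lt_skipTwo (i x y : ℕ) : skipTwo i x < skipTwo i y ↔ x < y := by
  grind [skipTwo]

theorem joinEnds_ne (f : ℕ → ℕ) (i x : ℕ) (hf : ∀ x, f (f x) = x) (hi : f i ≠ i)
    (hi' : f (i + 1) ≠ i + 1) (h : x ≠ i) (h' : x ≠ i + 1) :
    joinEnds f i x ≠ i ∧ joinEnds f i x ≠ i + 1 := by
  have h1 := hf x
  have h2 := hf i
  have h3 := hf (i + 1)
  unfold joinEnds
  split_ifs <;> grind

theorem joinEnds_joinEnds (f : ℕ → ℕ) (i x : ℕ) (hf : ∀ x, f (f x) = x) (h : x ≠ i)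
    (h' : x ≠ i + 1) : joinEnds f i (joinEnds f i x) = x := by
  have h1 := hf x
  have h2 := hf i
  have h3 := hf (i + 1)
  by_cases a : f x = i
  · have : joinEnds f i x = f (i + 1) := by simp [joinEnds, a]
    rw [this]; grind [joinEnds]
  by_cases b : f x = i + 1
  · have : joinEnds f i x = f i := by simp [joinEnds, b]
    rw [this]; grind [joinEnds]
  · have : joinEnds f i x = f x := by simp [joinEnds, a, b]
    rw [this]; grind [joinEnds]

theorem joinEnds_noncrossing (f : ℕ → ℕ) (i x y : ℕ) (hf : ∀ x, f (f x) = x)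
    (hn : ∀ x y, ¬ (x < y ∧ y < f x ∧ f x < f y)) (hx : x ≠ i ∧ x ≠ i + 1)
    (hy : y ≠ i ∧ y ≠ i + 1) :
    ¬ (x < y ∧ y < joinEnds f i x ∧ joinEnds f i x < joinEnds f i y) := by
  have hfx := hf x
  have hfy := hf y
  have n1 := hn x y
  by_cases a : f x = i
  · have fi : f i = x := by rw [← a]; exact hfx
    have e : joinEnds f i x = f (i + 1) := by simp [joinEnds, a]
    by_cases c : f y = i
    · have : y = x := by rw [← hfy, c, fi]
      omega
    by_cases d : f y = i + 1
    · have : f (i + 1) = y := by rw [← d]; exact hfy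
      omega
    have e' : joinEnds f i y = f y := by simp [joinEnds, c, d]
    have n2 := hn y (f (i + 1))
    have n3 := hn (i + 1) y
    rw [hf (i + 1)] at n2
    omega
  by_cases b : f x = i + 1
  · have fi : f (i + 1) = x := by rw [← b]; exact hfx
    have e : joinEnds f i x = f i := by simp [joinEnds, b]
    by_cases c : f y = i
    · have : f i = y := by rw [← c]; exact hfy
      omega
    by_cases d : f y = i + 1
    · have : y = x := by rw [← hfy, d, fi]
      omega
    have e' : joinEnds f i y = f y := by simp [joinEnds, c, d]
    have n2 := hn y (f i)
    have n3 := hn i y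
    rw [hf i] at n2
    omega
  have e : joinEnds f i x = f x := by simp [joinEnds, a, b]
  by_cases c : f y = i
  · have fi : f i = y := by rw [← c]; exact hfy
    have e' : joinEnds f i y = f (i + 1) := by simp [joinEnds, c]
    have n2 := hn x (i + 1)
    have n3 := hn i (i + 1)
    omega
  by_cases d : f y = i + 1
  · have fi : f (i + 1) = y := by rw [← d]; exact hfy
    have e' : joinEnds f i y = f i := by simp [joinEnds, d]
    have n2 := hn x i
    have n3 := hn (i + 1) x
    omega
  have e' : joinEnds f i y = f y := by simp [joinEnds, c, d]
  omega

namespace BasisWeb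

/-- `2 a` marked points joined by `a` nested arcs. -/
def nested (a : ℕ) : BasisWeb (a + a) where
  partner x := if x < a + a then a + a - 1 - x else x
  partner_of_le := by intro x hx; split_ifs <;> omega
  partner_lt := by intro x hx; split_ifs; omega
  partner_ne := by intro x hx; split_ifs; omega
  partner_partner := by intro x; split_ifs <;> omega
  noncrossing := by intro x y; split_ifs <;> omega

/-- Add an arc joining two new adjacent marked points `i` and `i + 1`. -/
def cup {m m' : ℕ} (i : ℕ) (hm : m' = m + 2) (hi : i ≤ m) (w : BasisWeb m) : BasisWeb m' where
  partner x :=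
    if x = i then i + 1 else if x = i + 1 then i else skipTwo i (w.partner (dropTwo i x))
  partner_of_le := by
    intro x hx
    have := w.partner_of_le (x - 2) (by omega)
    grind [skipTwo, dropTwo]
  partner_lt := by
    intro x hx
    have := w.partner_lt
    grind [skipTwo, dropTwo]
  partner_ne := by
    intro x hx
    have := w.partner_ne
    grind [skipTwo, dropTwo]
  partner_partner := by
    intro x
    by_cases h : x = i
    · simp [h]
    by_cases h' : x = i + 1
    · simp [h']
    have h1 := skipTwo_ne i (w.partner (dropTwo i x))
    simp [h, h', h1.1, h1.2, dropTwo_skipTwo, w.partner_partner, skipTwo_dropTwo]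
  noncrossing := by
    intro x y
    by_cases h : x = i
    · simp only [h, if_true]; omega
    by_cases h' : x = i + 1
    · simp only [h', if_true]; split_ifs <;> omega
    by_cases k : y = i
    · simp only [h, h', k, if_true, if_false]
      have h1 := skipTwo_ne i (w.partner (dropTwo i x))
      omega
    by_cases k' : y = i + 1
    · simp only [h, h', k', if_true, if_false]
      split_ifs <;> omega
    simp only [h, h', k, k', if_false]
    rw [skipTwo_lt_skipTwo]
    have hx := skipTwo_dropTwo i x h h'
    have hy := skipTwo_dropTwo i y k k'
    have e1 : x < y ↔ dropTwo i x < dropTwo i y := by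
      rw [← skipTwo_lt_skipTwo i (dropTwo i x), hx, hy]
    have e2 : y < skipTwo i (w.partner (dropTwo i x)) ↔ dropTwo i y < w.partner (dropTwo i x) := by
      rw [← skipTwo_lt_skipTwo i (dropTwo i y), hy]
    rw [e1, e2]
    exact w.noncrossing _ _

/-- Join the ends of the arcs at the adjacent marked points `i` and `i + 1` to each other, and
remove these two points; if `i` and `i + 1` are joined by an arc, the closed loop that results is
discarded. -/
def cap {m m' : ℕ} (i : ℕ) (hm : m = m' + 2) (hi : i ≤ m') (w : BasisWeb m) : BasisWeb m' where
  partner x := dropTwo i (joinEnds w.partner i (skipTwo i x))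
  partner_of_le := by
    intro x hx
    have := w.partner_of_le (x + 2) (by omega)
    grind [skipTwo, dropTwo, joinEnds]
  partner_lt := by
    intro x hx
    have h1 := w.partner_lt
    have hi1 := w.partner_ne i (by omega)
    have hi2 := w.partner_ne (i + 1) (by omega)
    have hs := skipTwo_ne i x
    have hj := joinEnds_ne w.partner i (skipTwo i x) w.partner_partner hi1 hi2 hs.1 hs.2
    have hl : joinEnds w.partner i (skipTwo i x) < m := by
      have : skipTwo i x < m := by unfold skipTwo; split_ifs <;> omega
      unfold joinEnds
      split_ifs
      · exact h1 _ (by omega)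
      · exact h1 _ (by omega)
      · exact h1 _ this
    unfold dropTwo
    split_ifs <;> omega
  partner_ne := by
    intro x hx h
    have hi1 := w.partner_ne i (by omega)
    have hi2 := w.partner_ne (i + 1) (by omega)
    have hs := skipTwo_ne i x
    have hj := joinEnds_ne w.partner i (skipTwo i x) w.partner_partner hi1 hi2 hs.1 hs.2
    have h0 : joinEnds w.partner i (skipTwo i x) = skipTwo i x := by
      rw [← skipTwo_dropTwo i (joinEnds w.partner i (skipTwo i x)) hj.1 hj.2, h]
    have h1 := w.partner_ne (skipTwo i x) (by unfold skipTwo; split_ifs <;> omega)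
    have h2 := w.partner_partner (skipTwo i x)
    have h3 := w.partner_partner i
    have h4 := w.partner_partner (i + 1)
    unfold joinEnds at h0
    split_ifs at h0 <;> grind
  partner_partner := by
    intro x
    have hi1 := w.partner_ne i (by omega)
    have hi2 := w.partner_ne (i + 1) (by omega)
    have hs := skipTwo_ne i x
    have hj := joinEnds_ne w.partner i (skipTwo i x) w.partner_partner hi1 hi2 hs.1 hs.2
    rw [skipTwo_dropTwo i _ hj.1 hj.2, joinEnds_joinEnds _ _ _ w.partner_partner hs.1 hs.2,
      dropTwo_skipTwo]
  noncrossing := by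
    intro x y
    have hi1 := w.partner_ne i (by omega)
    have hi2 := w.partner_ne (i + 1) (by omega)
    have hs := skipTwo_ne i x
    have hj := joinEnds_ne w.partner i (skipTwo i x) w.partner_partner hi1 hi2 hs.1 hs.2
    have hs' := skipTwo_ne i y
    have hj' := joinEnds_ne w.partner i (skipTwo i y) w.partner_partner hi1 hi2 hs'.1 hs'.2
    have := joinEnds_noncrossing w.partner i _ _ w.partner_partner w.noncrossing hs hs'
    rwa [← skipTwo_lt_skipTwo i x y, ← skipTwo_lt_skipTwo i y, ← skipTwo_lt_skipTwo i (dropTwo i _),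
      skipTwo_dropTwo i _ hj.1 hj.2, skipTwo_dropTwo i _ hj'.1 hj'.2]

end BasisWeb

/-- Adding an arc joining two new adjacent marked points, as a linear map of web spaces. -/
def cupMap {m m' : ℕ} (i : ℕ) (hm : m' = m + 2) (hi : i ≤ m) :
    WebSpace m →ₗ[CoeffField] WebSpace m' :=
  Finsupp.linearCombination CoeffField fun w => Finsupp.single (w.cup i hm hi) 1

open Classical in
/-- Joining the ends at two adjacent marked points, as a linear map of web spaces: if this closes
up a loop, the loop is replaced by the factor `-[2]`. -/
def capMap {m m' : ℕ} (i : ℕ) (hm : m = m' + 2) (hi : i ≤ m') :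
    WebSpace m →ₗ[CoeffField] WebSpace m' :=
  Finsupp.linearCombination CoeffField fun w =>
    Finsupp.single (w.cap i hm hi) (if w.partner i = i + 1 then -quantumInt 2 else 1)

/-- Joining the ends at the marked points `i` and `i + 1` and adding a new arc there. -/
def turnMap {m : ℕ} (i : ℕ) (hi : i + 1 < m) : WebSpace m →ₗ[CoeffField] WebSpace m :=
  cupMap (m := m - 2) i (by omega) (by omega) ∘ₗ capMap i (by omega) (by omega)

/-- Attaching the clasp (Jones–Wenzl projector) of color `n` to the marked points
`i, …, i + n - 1`: the clasps of color `0` and `1` are parallel strands, and the clasp of color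
`n + 1` is the clasp of color `n` beside one strand, plus `[n] / [n + 1]` times two clasps of color
`n` with the web between them that has `n - 1` straight strands and a turnback on each side. -/
def claspMap {m : ℕ} (i : ℕ) : ∀ n : ℕ, i + n ≤ m → (WebSpace m →ₗ[CoeffField] WebSpace m)
  | 0, _ => LinearMap.id
  | 1, _ => LinearMap.id
  | n + 2, h =>
    claspMap i (n + 1) (by omega) +
      (quantumInt (n + 1) / quantumInt (n + 2)) •
        (claspMap i (n + 1) (by omega) ∘ₗ turnMap (i + n) (by omega) ∘ₗ
          claspMap i (n + 1) (by omega))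

/-! ### Tangle diagrams and the Kauffman bracket -/

/-- Tangle diagrams with clasps in a rectangle with `a` marked points on the left edge and a number
of marked points on the right edge, in general position with respect to the horizontal coordinate:
read from the left to the right, such a diagram is built from `a` parallel strands by adding one
feature at a time at the right end. The current right ends are numbered `0, 1, 2, …` from the top
to the bottom. -/
inductive TangleDiagram (a : ℕ) : ℕ → Type
  /-- `a` parallel strands. -/
  | strands : TangleDiagram a a
  /-- An arc `⊂` with two new right ends `i` and `i + 1`. -/
  | cup {b b' : ℕ} (i : ℕ) (hb : b' = b + 2) (hi : i ≤ b) (D : TangleDiagram a b) :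
      TangleDiagram a b'
  /-- An arc `⊃` joining the right ends `i` and `i + 1`. -/
  | cap {b b' : ℕ} (i : ℕ) (hb : b = b' + 2) (hi : i ≤ b') (D : TangleDiagram a b) :
      TangleDiagram a b'
  /-- A crossing of the strands `i` and `i + 1`; the strand from the upper left to the lower right
  is the overstrand. -/
  | over {b : ℕ} (i : ℕ) (hi : i + 1 < b) (D : TangleDiagram a b) : TangleDiagram a b
  /-- A crossing of the strands `i` and `i + 1`; the strand from the upper left to the lower right
  is the understrand. -/
  | under {b : ℕ} (i : ℕ) (hi : i + 1 < b) (D : TangleDiagram a b) : TangleDiagram a b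
  /-- A clasp of color `n` on the `n` strands `i, …, i + n - 1`. -/
  | clasp {b : ℕ} (i n : ℕ) (hi : i + n ≤ b) (D : TangleDiagram a b) : TangleDiagram a b

namespace TangleDiagram

/-- The Kauffman bracket of a tangle diagram with `a` left and `b` right ends, an element of the
web space `W_{a+b}`. The marked points are numbered clockwise from the lowest one on the left edge:
those on the left edge are `0, …, a - 1` from the bottom to the top, those on the right edge are
`a, …, a + b - 1` from the top to the bottom. A crossing is `q^{1/4}` times one of its two
smoothings (`=` if the overstrand goes from the upper left to the lower right, `⊃⊂` otherwise) plus
`q^{-1/4}` times the other one, and a closed loop is `-[2]`. -/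
def bracket {a : ℕ} : {b : ℕ} → TangleDiagram a b → WebSpace (a + b)
  | _, .strands => Finsupp.single (BasisWeb.nested a) 1
  | _, .cup i hb hi D => cupMap (a + i) (by omega) (by omega) D.bracket
  | _, .cap i hb hi D => capMap (a + i) (by omega) (by omega) D.bracket
  | _, .over i hi D =>
      qPow 1 • D.bracket + qPow (-1) • turnMap (a + i) (by omega) D.bracket
  | _, .under i hi D =>
      qPow 1 • turnMap (a + i) (by omega) D.bracket + qPow (-1) • D.bracket
  | _, .clasp i n hi D => claspMap (a + i) n (by omega) D.bracket

/-- The same diagram, for two expressions of its number of right ends. -/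
def cast {a b b' : ℕ} (h : b = b') (D : TangleDiagram a b) : TangleDiagram a b' := h ▸ D

/-- The strand `i + c` crosses under the `c` strands `i, …, i + c - 1` above it and becomes the
strand `i`. -/
def passUnder {a b : ℕ} (i : ℕ) :
    ∀ c : ℕ, i + c < b → TangleDiagram a b → TangleDiagram a b
  | 0, _, D => D
  | c + 1, h, D => passUnder i c (by omega) (D.over (i + c) (by omega))

/-- A crossing of two cables: the `c` strands `i, …, i + c - 1` go down over the `d` strands below
them, each of the latter going up under each of the former. -/
def cableCrossing {a b : ℕ} (i c : ℕ) :
    ∀ d : ℕ, i + c + d ≤ b → TangleDiagram a b → TangleDiagram a b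
  | 0, _, D => D
  | d + 1, h, D => passUnder (i + d) c (by omega) (cableCrossing i c d (by omega) D)

/-- A right-handed half twist of two parallel strands of color `n`. -/
def halfTwist {a : ℕ} (n : ℕ) (D : TangleDiagram a (2 * n)) : TangleDiagram a (2 * n) :=
  cableCrossing 0 n n (by omega) D

/-- Two clasps of color `n`, one on the upper `n` strands and one on the lower `n` strands. -/
def twoClasps {a : ℕ} (n : ℕ) (D : TangleDiagram a (2 * n)) : TangleDiagram a (2 * n) :=
  (D.clasp 0 n (by omega)).clasp n n (by omega)

/-- `j` nested arcs `⊃` in the middle, between `k` upper and `k` lower strands. -/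
def nestedCaps {a : ℕ} (k : ℕ) :
    ∀ j : ℕ, TangleDiagram a (2 * (k + j)) → TangleDiagram a (2 * k)
  | 0, D => D
  | j + 1, D => nestedCaps k j (D.cap (k + j) (by omega) (by omega))

/-- `j` nested arcs `⊂` in the middle, between `k` upper and `k` lower strands. -/
def nestedCups {a : ℕ} (k : ℕ) :
    ∀ j : ℕ, TangleDiagram a (2 * k) → TangleDiagram a (2 * (k + j))
  | 0, D => D
  | j + 1, D => (nestedCups k j D).cup (k + j) (by omega) (by omega)

/-- Two parallel strands of color `n` with `m` right-handed half twists, and with clasps of color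
`n` at the two left ends and at the two right ends. -/
def claspedTwist (n m : ℕ) : TangleDiagram (2 * n) (2 * n) :=
  twoClasps n ((halfTwist n)^[m] (twoClasps n strands))

/-- The diagram with clasps of color `n` at the two left ends and at the two right ends, in which
the two upper clasps are joined by `k` parallel strands, the two lower clasps by `k` parallel
strands, and the two left clasps, as well as the two right clasps, by `n - k` parallel strands. -/
def claspedWeb (n k : ℕ) (hk : k ≤ n) : TangleDiagram (2 * n) (2 * n) :=
  twoClasps n
    ((nestedCups k (n - k) (nestedCaps k (n - k) ((twoClasps n strands).cast (by omega)))).cast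
      (by omega))

end TangleDiagram

end KauffmanSkein

end

/-!
The bracket of a tangle diagram is obtained by letting one linear operator per feature act on the
diagram of parallel strands, and the proof is a computation with these operators alone.

*Operators.* The maps `cupMap` and `capMap` change the size of the web space. To compose them
without keeping track of sizes, the web spaces are embedded (`toOpen`) in one space, spanned by the
involutions of `ℕ`, on which `openCup i` and `openCap i` are everywhere defined and satisfy the
relations of planar isotopy, with loop value `-[2]`, without side conditions on the size
(`openWeb_relations`). `toOpen_bracket` expresses the bracket in terms of these operators. From then
on everything takes place in an arbitrary algebra with elements `cup i`, `cap i` subject to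
`CupCapRelations`.

*Clasps.* The only property of clasps that is needed is that they are killed by a cap or cup on two
neighbouring strands (`cap_mul_claspElt`, `claspElt_mul_cup`). So the clasps on the two sides are
replaced by arbitrary elements `φ` and `v` with `φ * cup i = 0` and `cap i * v = 0` for all `i` but
the one between the two cables.

*One half twist.* Let `X c d` be the crossing of a cable of `c` strands over one of `d` strands. In
`φ * X c (d + 1) * v`, expand the crossings on the last of the `d + 1` strands. All but two of the
smoothings die on `φ` or `v`. In one of the two survivors the last strand runs straight to the
bottom, which leaves `X c d`; in the other one it turns back, and sliding the turnback to the left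
through `X c d` leaves `X (c - 1) d` between a cup and a cap (`mul_crossing_mul`). The two
coefficients make this Pascal's recursion for Gaussian binomials, and `φ * X n n * v` is the sum
over `k ≤ n` of `q ^ ((2 k² - n²) / 4)` times the Gaussian binomial times the web with `n - k`
turnbacks on each side (`mul_crossing_mul_eq_sum`).

*More half twists.* A half twist next to `n - k` turnbacks comes undone on the `n - k` strands: the
curl in the innermost arc gives `-q ^ (-3/4)`, and the arc is slid across the rest of the twist to
the other side, where its crossings with the other strands are absorbed by `φ`
(`crossing_mul_cup`, `mul_crossing_mul_nestedCupElt`). This leaves a half twist of two cables of `k`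
strands, again between elements killed by all but one cup and cap. Hence the formula for `m + 1` half
twists on `n` strands follows from those for `m` half twists on `k ≤ n` strands
(`mul_crossing_pow_mul`), and the products of the coefficients along a chain `k₁ ≥ k₂ ≥ ⋯` telescope
to those of the theorem (`twistCoeff_succ`).
-/

namespace KauffmanSkein

noncomputable section

/-! ### Powers of the variable, quantum integers and Gaussian binomials -/

theorem qPow_add (a b : ℤ) : qPow (a + b) = qPow a * qPow b := zpow_add₀ RatFunc.X_ne_zero a b
theorem qPow_ne_zero (a : ℤ) : qPow a ≠ 0 := zpow_ne_zero a RatFunc.X_ne_zero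
theorem qPow_zero : qPow 0 = 1 := zpow_zero _
theorem qPow_pow (a : ℤ) (n : ℕ) : qPow a ^ n = qPow (a * n) := by
  simp [qPow, zpow_mul]
theorem qPow_neg (a : ℤ) : qPow (-a) = (qPow a)⁻¹ := zpow_neg _ a

theorem qPow_ne_one {a : ℤ} (ha : a ≠ 0) : qPow a ≠ 1 := by
  have key : ∀ n : ℕ, n ≠ 0 → (RatFunc.X : RatFunc ℚ) ^ n ≠ 1 := by
    intro n hn h
    rw [← RatFunc.algebraMap_X, ← map_pow, ← map_one (algebraMap (Polynomial ℚ) (RatFunc ℚ))] at h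
    have h2 := congrArg Polynomial.natDegree (RatFunc.algebraMap_injective ℚ h)
    simp at h2
    exact hn h2
  intro h
  rcases Int.natAbs_eq a with h1 | h1
  · exact key a.natAbs (by omega) (by rw [← zpow_natCast, ← h1]; exact h)
  · refine key a.natAbs (by omega) ?_
    rw [h1, qPow_neg, inv_eq_one] at h
    rw [← zpow_natCast]; exact h

theorem qPow_injective {a b : ℤ} (h : qPow a = qPow b) : a = b := by
  by_contra hab
  refine qPow_ne_one (sub_ne_zero.2 hab) ?_
  rw [sub_eq_add_neg, qPow_add, qPow_neg, h, mul_inv_cancel₀ (qPow_ne_zero b)]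

theorem quantumInt_den_ne_zero : qPow 2 - qPow (-2) ≠ 0 :=
  sub_ne_zero.2 fun h => by have := qPow_injective h; omega

theorem quantumInt_ne_zero {k : ℤ} (hk : k ≠ 0) : quantumInt k ≠ 0 :=
  div_ne_zero (sub_ne_zero.2 fun h => by have := qPow_injective h; omega) quantumInt_den_ne_zero

theorem quantumInt_one : quantumInt 1 = 1 := div_self quantumInt_den_ne_zero

theorem quantumInt_two : quantumInt 2 = qPow 2 + qPow (-2) := by
  rw [quantumInt, div_eq_iff quantumInt_den_ne_zero]
  rw [add_mul, mul_sub, mul_sub]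
  simp only [← qPow_add]
  norm_num

theorem quantumInt_two_mul (k : ℤ) :
    quantumInt 2 * quantumInt k = quantumInt (k + 1) + quantumInt (k - 1) := by
  rw [quantumInt_two, quantumInt, quantumInt, quantumInt, ← add_div, mul_div_assoc']
  congr 1
  rw [add_mul, mul_sub, mul_sub]
  simp only [← qPow_add]
  rw [show 2 + 2 * k = 2 * (k + 1) by ring, show 2 + -(2 * k) = -(2 * (k - 1)) by ring,
    show -2 + 2 * k = 2 * (k - 1) by ring, show -2 + -(2 * k) = -(2 * (k + 1)) by ring]
  ring

theorem one_sub_q_pow_ne_zero {l : ℕ} (hl : l ≠ 0) : 1 - q ^ l ≠ 0 := by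
  rw [q, qPow_pow]
  exact sub_ne_zero.2 (Ne.symm (qPow_ne_one (by omega)))

theorem qPochhammer_ne_zero (k : ℕ) : qPochhammer k ≠ 0 :=
  Finset.prod_ne_zero_iff.2 fun l hl => one_sub_q_pow_ne_zero (by simp at hl; omega)

theorem qPochhammer_succ (k : ℕ) : qPochhammer (k + 1) = qPochhammer k * (1 - q ^ (k + 1)) := by
  rw [qPochhammer, Finset.prod_Icc_succ_top (by omega)]; rfl

/-- The Gaussian binomial coefficient, defined by Pascal's recursion; it is `0` if the lower index
exceeds the upper one. -/
def gaussBinom : ℕ → ℕ → CoeffField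
  | _, 0 => 1
  | 0, _ + 1 => 0
  | d + 1, u + 1 => q ^ (u + 1) * gaussBinom d (u + 1) + gaussBinom d u

theorem gaussBinom_eq_zero : ∀ {d u : ℕ}, d < u → gaussBinom d u = 0
  | 0, u + 1, _ => rfl
  | d + 1, u + 1, h => by
    rw [gaussBinom, gaussBinom_eq_zero (by omega), gaussBinom_eq_zero (by omega)]; simp

/-- The Gaussian binomial coefficient as a quotient of `q`-Pochhammer symbols, with the denominator
cleared. -/
theorem gaussBinom_mul : ∀ u v : ℕ,
    gaussBinom (u + v) u * (qPochhammer u * qPochhammer v) = qPochhammer (u + v)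
  | 0, v => by simp [gaussBinom, qPochhammer]
  | u + 1, 0 => by
    have h := gaussBinom_mul u 0
    rw [add_zero] at h ⊢
    rw [gaussBinom, gaussBinom_eq_zero (by omega), qPochhammer_succ]
    linear_combination (1 - q ^ (u + 1)) * h
  | u + 1, v + 1 => by
    have h1 := gaussBinom_mul (u + 1) v
    have h2 := gaussBinom_mul u (v + 1)
    rw [show u + 1 + (v + 1) = (u + 1 + v) + 1 by ring, gaussBinom, qPochhammer_succ (u + 1 + v)]
    rw [show u + (v + 1) = u + 1 + v by ring] at h2
    rw [qPochhammer_succ u, qPochhammer_succ v] at *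
    have e : q ^ (u + 1 + v + 1) = q ^ (u + 1) * q ^ (v + 1) := by rw [← pow_add]; congr 1
    rw [e]
    linear_combination q ^ (u + 1) * (1 - q ^ (v + 1)) * h1 + (1 - q ^ (u + 1)) * h2

/-! ### Matchings of all natural numbers -/

section

/-- The involution `f`, viewed as a matching of the natural numbers, after an arc has been inserted
at two new points `i` and `i + 1`. -/
def cupFun (i : ℕ) (f : ℕ → ℕ) (x : ℕ) : ℕ :=
  if x = i then i + 1 else if x = i + 1 then i else skipTwo i (f (dropTwo i x))

/-- The partner of `x ≠ i, i + 1` after the ends at `i` and `i + 1` have been joined. In contrast to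
`joinEnds`, fixed points of `f` are taken into account: they are the ends of strands that run to
infinity, and joining such a strand to the one from `x` makes `x` a fixed point. -/
def joinOpen (f : ℕ → ℕ) (i x : ℕ) : ℕ :=
  if f x = i then (if f (i + 1) = i + 1 then x else f (i + 1))
  else if f x = i + 1 then (if f i = i then x else f i) else f x

/-- The matching `f` after the ends at `i` and `i + 1` have been joined and removed. -/
def capFun (i : ℕ) (f : ℕ → ℕ) (x : ℕ) : ℕ := dropTwo i (joinOpen f i (skipTwo i x))

variable {f : ℕ → ℕ} (hf : ∀ x, f (f x) = x)
include hf

theorem cupFun_inv (i x : ℕ) : cupFun i f (cupFun i f x) = x := by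
  grind (splits := 30) [skipTwo, dropTwo, cupFun]

theorem joinOpen_ne (i x : ℕ) (h : x ≠ i) (h' : x ≠ i + 1) :
    joinOpen f i x ≠ i ∧ joinOpen f i x ≠ i + 1 := by
  grind (splits := 30) [joinOpen]

theorem skip_capFun (i x : ℕ) : skipTwo i (capFun i f x) = joinOpen f i (skipTwo i x) := by
  have := skipTwo_ne i x
  have := joinOpen_ne hf i (skipTwo i x) this.1 this.2
  exact skipTwo_dropTwo _ _ this.1 this.2

theorem joinOpen_inv (i x : ℕ) (h : x ≠ i) (h' : x ≠ i + 1) :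
    joinOpen f i (joinOpen f i x) = x := by
  have := hf x
  have := hf i
  have := hf (i + 1)
  grind (splits := 30) [joinOpen]

theorem capFun_inv (i x : ℕ) : capFun i f (capFun i f x) = x := by
  have h := skipTwo_ne i x
  rw [capFun, skip_capFun hf, joinOpen_inv hf i _ h.1 h.2, dropTwo_skipTwo]

omit hf in
theorem capFun_cupFun_self (i x : ℕ) : capFun i (cupFun i f) x = f x := by
  grind (splits := 30) [skipTwo, dropTwo, joinOpen, capFun, cupFun]

omit hf in
theorem capFun_cupFun_succ (i x : ℕ) : capFun i (cupFun (i + 1) f) x = f x := by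
  grind (splits := 30) [skipTwo, dropTwo, joinOpen, capFun, cupFun]

omit hf in
theorem capFun_succ_cupFun (i x : ℕ) : capFun (i + 1) (cupFun i f) x = f x := by
  grind (splits := 30) [skipTwo, dropTwo, joinOpen, capFun, cupFun]

omit hf in
theorem cupFun_cupFun {i j : ℕ} (h : i ≤ j) (x : ℕ) :
    cupFun (j + 2) (cupFun i f) x = cupFun i (cupFun j f) x := by
  grind (splits := 30) [skipTwo, dropTwo, cupFun]

theorem capFun_cupFun_of_le {i j : ℕ} (h : i ≤ j) (x : ℕ) :
    capFun i (cupFun (j + 2) f) x = cupFun j (capFun i f) x := by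
  grind (splits := 30) [skipTwo, dropTwo, joinOpen, capFun, cupFun]

theorem capFun_cupFun_of_ge {i j : ℕ} (h : i ≤ j) (x : ℕ) :
    capFun (j + 2) (cupFun i f) x = cupFun i (capFun j f) x := by
  grind (splits := 30) [skipTwo, dropTwo, joinOpen, capFun, cupFun]

/-- Joining at `i`, `i + 1` and joining at `j + 2`, `j + 3` commute. -/
theorem joinOpen_joinOpen_comm {i j : ℕ} (h : i ≤ j) (y : ℕ) (h1 : y ≠ i) (h2 : y ≠ i + 1)
    (h3 : y ≠ j + 2) (h4 : y ≠ j + 3) :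
    joinOpen (joinOpen f (j + 2)) i y = joinOpen (joinOpen f i) (j + 2) y := by
  have := hf y
  have := hf i
  have := hf (i + 1)
  have := hf (j + 2)
  have := hf (j + 3)
  grind (splits := 50) [joinOpen]

/-- Joining at `i`, `i + 1` after `capFun (j + 2)`, in the numbering of the points before it. -/
theorem skip_joinOpen_le {i j : ℕ} (h : i ≤ j) (x : ℕ) :
    skipTwo (j + 2) (joinOpen (capFun (j + 2) f) i x) =
      joinOpen (joinOpen f (j + 2)) i (skipTwo (j + 2) x) := by
  have h0 := skip_capFun hf (j + 2)
  have e1 : skipTwo (j + 2) i = i := by grind [skipTwo]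
  have e2 : skipTwo (j + 2) (i + 1) = i + 1 := by grind [skipTwo]
  have inj : ∀ x y, skipTwo (j + 2) x = skipTwo (j + 2) y ↔ x = y := by grind [skipTwo]
  unfold joinOpen
  have a1 := inj (capFun (j + 2) f x) i
  have a2 := inj (capFun (j + 2) f x) (i + 1)
  have a3 := inj (capFun (j + 2) f i) i
  have a4 := inj (capFun (j + 2) f (i + 1)) (i + 1)
  rw [h0] at a1 a2 a3 a4
  rw [e1] at a1 a3
  rw [e2] at a2 a4
  change _ = if joinOpen f (j + 2) (skipTwo (j + 2) x) = i then
    (if joinOpen f (j + 2) (i + 1) = i + 1 then _ else joinOpen f (j + 2) (i + 1)) else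
    if joinOpen f (j + 2) (skipTwo (j + 2) x) = i + 1 then
      (if joinOpen f (j + 2) i = i then _ else joinOpen f (j + 2) i) else
    joinOpen f (j + 2) (skipTwo (j + 2) x)
  simp only [apply_ite (skipTwo (j + 2)), h0, e1, e2, a1, a2, a3, a4]

/-- Joining at `j`, `j + 1` after `capFun i`, in the numbering of the points before it. -/
theorem skip_joinOpen_ge {i j : ℕ} (h : i ≤ j) (x : ℕ) :
    skipTwo i (joinOpen (capFun i f) j x) =
      joinOpen (joinOpen f i) (j + 2) (skipTwo i x) := by
  have h0 := skip_capFun hf i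
  have e1 : skipTwo i j = j + 2 := by grind [skipTwo]
  have e2 : skipTwo i (j + 1) = j + 2 + 1 := by grind [skipTwo]
  have inj : ∀ x y, skipTwo i x = skipTwo i y ↔ x = y := by grind [skipTwo]
  unfold joinOpen
  have a1 := inj (capFun i f x) j
  have a2 := inj (capFun i f x) (j + 1)
  have a3 := inj (capFun i f j) j
  have a4 := inj (capFun i f (j + 1)) (j + 1)
  rw [h0] at a1 a2 a3 a4
  rw [e1] at a1 a3
  rw [e2] at a2 a4
  change _ = if joinOpen f i (skipTwo i x) = j + 2 then
    (if joinOpen f i (j + 2 + 1) = j + 2 + 1 then _ else joinOpen f i (j + 2 + 1)) else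
    if joinOpen f i (skipTwo i x) = j + 2 + 1 then
      (if joinOpen f i (j + 2) = j + 2 then _ else joinOpen f i (j + 2)) else
    joinOpen f i (skipTwo i x)
  simp only [apply_ite (skipTwo i), h0, e1, e2, a1, a2, a3, a4]

theorem capFun_capFun {i j : ℕ} (h : i ≤ j) (x : ℕ) :
    capFun i (capFun (j + 2) f) x = capFun j (capFun i f) x := by
  have inj : ∀ x y, skipTwo (j + 2) (skipTwo i x) = skipTwo (j + 2) (skipTwo i y) → x = y := by
    grind [skipTwo]
  have comm : ∀ x, skipTwo (j + 2) (skipTwo i x) = skipTwo i (skipTwo j x) := by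
    grind [skipTwo]
  apply inj
  rw [skip_capFun (capFun_inv hf (j + 2)), skip_joinOpen_le hf h, comm, comm,
    skip_capFun (capFun_inv hf i), skip_joinOpen_ge hf h]
  apply joinOpen_joinOpen_comm hf h <;> grind [skipTwo]

/-- Two caps in either order close up the same number of loops. -/
theorem capFun_capFun_weight {i j : ℕ} (h : i ≤ j) {K : Type*} [CommRing K] (δ : K) :
    (if f (j + 2) = j + 2 + 1 then δ else 1) * (if capFun (j + 2) f i = i + 1 then δ else 1) =
      (if f i = i + 1 then δ else 1) * (if capFun i f j = j + 1 then δ else 1) := by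
  have b1 : capFun (j + 2) f i = i + 1 ↔ joinOpen f (j + 2) i = i + 1 := by
    have := skip_capFun hf (j + 2) i
    grind [skipTwo]
  have b2 : capFun i f j = j + 1 ↔ joinOpen f i (j + 2) = j + 3 := by
    have := skip_capFun hf i j
    grind [skipTwo]
  simp only [b1, b2]
  have := hf i
  have := hf (i + 1)
  have := hf (j + 2)
  have := hf (j + 3)
  grind (splits := 30) [joinOpen]
end

/-! ### The operators on the space of open webs -/

/-- An open web: a matching of all natural numbers, with some points (the fixed points) joined to
infinity. Since there are infinitely many points, arcs can be attached and ends can be joined at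
every position. Noncrossing matchings are not singled out, as the relations do not depend on it. -/
abbrev OpenWeb : Type := {f : ℕ → ℕ // ∀ x, f (f x) = x}

/-- The vector space with basis the open webs. -/
abbrev OpenWebSpace : Type := OpenWeb →₀ CoeffField

/-- Attaching an arc with two new ends `i` and `i + 1`. -/
def openCup (i : ℕ) : Module.End CoeffField OpenWebSpace :=
  Finsupp.linearCombination CoeffField fun f =>
    Finsupp.single (⟨cupFun i f.1, cupFun_inv f.2 i⟩ : OpenWeb) 1

/-- Joining the ends `i` and `i + 1`, with the factor `-[2]` if this closes up a loop. -/
def openCap (i : ℕ) : Module.End CoeffField OpenWebSpace :=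
  Finsupp.linearCombination CoeffField fun f =>
    Finsupp.single (⟨capFun i f.1, capFun_inv f.2 i⟩ : OpenWeb)
      (if f.1 i = i + 1 then -quantumInt 2 else 1)

/-- Elements `cup i`, `cap i` of an algebra that satisfy the relations of planar isotopy between arcs
`⊂` and `⊃` at positions `i`, `i + 1` in a row of strands, and in which a closed loop is `-[2]`. The
rightmost feature of a diagram is the leftmost factor of a product. -/
structure CupCapRelations {R : Type*} [Ring R] [Algebra CoeffField R] (cup cap : ℕ → R) : Prop where
  cap_cup_self (i : ℕ) : cap i * cup i = (-quantumInt 2) • 1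
  cap_cup_succ (i : ℕ) : cap i * cup (i + 1) = 1
  cap_succ_cup (i : ℕ) : cap (i + 1) * cup i = 1
  cap_cup_of_le {i j : ℕ} (h : i ≤ j) : cap i * cup (j + 2) = cup j * cap i
  cap_cup_of_ge {i j : ℕ} (h : i ≤ j) : cap (j + 2) * cup i = cup i * cap j
  cap_cap {i j : ℕ} (h : i ≤ j) : cap i * cap (j + 2) = cap j * cap i
  cup_cup {i j : ℕ} (h : i ≤ j) : cup (j + 2) * cup i = cup i * cup j

theorem openCup_single (i : ℕ) (f : OpenWeb) (c : CoeffField) :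
    openCup i (Finsupp.single f c) =
      Finsupp.single (⟨cupFun i f.1, cupFun_inv f.2 i⟩ : OpenWeb) c := by
  simp [openCup]

theorem openCap_single (i : ℕ) (f : OpenWeb) (c : CoeffField) :
    openCap i (Finsupp.single f c) =
      Finsupp.single (⟨capFun i f.1, capFun_inv f.2 i⟩ : OpenWeb)
        (c * if f.1 i = i + 1 then -quantumInt 2 else 1) := by
  simp [openCap]

theorem openWeb_relations : CupCapRelations openCup openCap := by
  constructor
  · intro i
    ext f : 1
    refine LinearMap.ext_ring ?_
    have e : (⟨_, capFun_inv (cupFun_inv f.2 i) i⟩ : OpenWeb) = f :=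
      Subtype.ext (funext fun x => capFun_cupFun_self i x)
    have w : cupFun i f.1 i = i + 1 := by simp [cupFun]
    simp [openCup_single, openCap_single, e, w]
  · intro i
    ext f : 1
    refine LinearMap.ext_ring ?_
    have e : (⟨_, capFun_inv (cupFun_inv f.2 (i + 1)) i⟩ : OpenWeb) = f :=
      Subtype.ext (funext fun x => capFun_cupFun_succ i x)
    have w : cupFun (i + 1) f.1 i ≠ i + 1 := by grind [cupFun, skipTwo]
    simp [openCup_single, openCap_single, e, w]
  · intro i
    ext f : 1
    refine LinearMap.ext_ring ?_
    have e : (⟨_, capFun_inv (cupFun_inv f.2 i) (i + 1)⟩ : OpenWeb) = f :=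
      Subtype.ext (funext fun x => capFun_succ_cupFun i x)
    have w : cupFun i f.1 (i + 1) ≠ i + 1 + 1 := by grind [cupFun, skipTwo]
    simp [openCup_single, openCap_single, e, w]
  · intro i j h
    ext f : 1
    refine LinearMap.ext_ring ?_
    have e : (⟨_, capFun_inv (cupFun_inv f.2 (j + 2)) i⟩ : OpenWeb) =
        ⟨_, cupFun_inv (capFun_inv f.2 i) j⟩ :=
      Subtype.ext (funext fun x => capFun_cupFun_of_le f.2 h x)
    have w : cupFun (j + 2) f.1 i = i + 1 ↔ f.1 i = i + 1 := by grind [cupFun, skipTwo, dropTwo]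
    simp [openCup_single, openCap_single, e, w]
  · intro i j h
    ext f : 1
    refine LinearMap.ext_ring ?_
    have e : (⟨_, capFun_inv (cupFun_inv f.2 i) (j + 2)⟩ : OpenWeb) =
        ⟨_, cupFun_inv (capFun_inv f.2 j) i⟩ :=
      Subtype.ext (funext fun x => capFun_cupFun_of_ge f.2 h x)
    have w : cupFun i f.1 (j + 2) = j + 2 + 1 ↔ f.1 j = j + 1 := by
      grind [cupFun, skipTwo, dropTwo]
    simp [openCup_single, openCap_single, e, w]
  · intro i j h
    ext f : 1
    refine LinearMap.ext_ring ?_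
    have e : (⟨_, capFun_inv (capFun_inv f.2 (j + 2)) i⟩ : OpenWeb) =
        ⟨_, capFun_inv (capFun_inv f.2 i) j⟩ :=
      Subtype.ext (funext fun x => capFun_capFun f.2 h x)
    have w := capFun_capFun_weight f.2 h (-quantumInt 2)
    simp only [Module.End.mul_apply, LinearMap.comp_apply, Finsupp.lsingle_apply, openCap_single, e,
      one_mul, w]
  · intro i j h
    ext f : 1
    refine LinearMap.ext_ring ?_
    have e : (⟨_, cupFun_inv (cupFun_inv f.2 i) (j + 2)⟩ : OpenWeb) =
        ⟨_, cupFun_inv (cupFun_inv f.2 j) i⟩ :=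
      Subtype.ext (funext fun x => cupFun_cupFun h x)
    simp [openCup_single, e]

/-- A basis web as an open web; the points that are not marked are joined to infinity. -/
def BasisWeb.toOpen {m : ℕ} (w : BasisWeb m) : OpenWeb := ⟨w.partner, w.partner_partner⟩

/-- The embedding of a web space in the space of open webs. -/
def toOpen (m : ℕ) : WebSpace m →ₗ[CoeffField] OpenWebSpace :=
  Finsupp.lmapDomain CoeffField CoeffField BasisWeb.toOpen

theorem toOpen_injective (m : ℕ) : Function.Injective (toOpen m) :=
  Finsupp.mapDomain_injective fun _ _ h => BasisWeb.ext (congrArg Subtype.val h)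

theorem toOpen_cupMap {m m' : ℕ} (i : ℕ) (hm : m' = m + 2) (hi : i ≤ m) (v : WebSpace m) :
    toOpen m' (cupMap i hm hi v) = openCup i (toOpen m v) := by
  suffices h : toOpen m' ∘ₗ cupMap i hm hi = openCup i ∘ₗ toOpen m from LinearMap.congr_fun h v
  ext w : 1
  refine LinearMap.ext_ring ?_
  simp only [LinearMap.comp_apply, Finsupp.lsingle_apply, toOpen, cupMap,
    Finsupp.linearCombination_single, one_smul, Finsupp.lmapDomain_apply, Finsupp.mapDomain_single,
    openCup_single]
  rfl

theorem toOpen_capMap {m m' : ℕ} (i : ℕ) (hm : m = m' + 2) (hi : i ≤ m') (v : WebSpace m) :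
    toOpen m' (capMap i hm hi v) = openCap i (toOpen m v) := by
  suffices h : toOpen m' ∘ₗ capMap i hm hi = openCap i ∘ₗ toOpen m from LinearMap.congr_fun h v
  ext w : 1
  refine LinearMap.ext_ring ?_
  simp only [LinearMap.comp_apply, Finsupp.lsingle_apply, toOpen, capMap,
    Finsupp.linearCombination_single, one_smul, Finsupp.lmapDomain_apply, Finsupp.mapDomain_single,
    openCap_single, one_mul]
  have e : (w.cap i hm hi).toOpen = ⟨_, capFun_inv w.toOpen.2 i⟩ := by
    refine Subtype.ext (funext fun x => ?_)
    have h1 := w.partner_ne i (by omega)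
    have h2 := w.partner_ne (i + 1) (by omega)
    simp [BasisWeb.toOpen, BasisWeb.cap, capFun, joinEnds, joinOpen, h1, h2]
  rw [e]
  simp only [BasisWeb.toOpen]
  congr!

section

variable {R : Type*} [Ring R]

/-! ### Crossings -/

section Products

/-- The product `f i * f (i + 1) * ⋯ * f (i + n - 1)`. -/
def ascProd (f : ℕ → R) (i : ℕ) : ℕ → R
  | 0 => 1
  | n + 1 => ascProd f i n * f (i + n)

/-- The product `f (i + n - 1) * ⋯ * f (i + 1) * f i`. -/
def descProd (f : ℕ → R) (i : ℕ) : ℕ → R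
  | 0 => 1
  | n + 1 => f (i + n) * descProd f i n

theorem ascProd_succ_left (f : ℕ → R) (i n : ℕ) :
    ascProd f i (n + 1) = f i * ascProd f (i + 1) n := by
  induction n with
  | zero => simp [ascProd]
  | succ n ih => rw [ascProd, ih, ascProd, mul_assoc, add_right_comm, add_assoc]

theorem SemiconjBy.ascProd_right {x : R} {f g : ℕ → R} {i j n : ℕ}
    (h : ∀ s < n, SemiconjBy x (f (i + s)) (g (j + s))) :
    SemiconjBy x (ascProd f i n) (ascProd g j n) := by
  induction n with
  | zero => exact SemiconjBy.one_right x
  | succ n ih => exact (ih fun s hs => h s (by omega)).mul_right (h n (by omega))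

theorem SemiconjBy.descProd_right {x : R} {f g : ℕ → R} {i j n : ℕ}
    (h : ∀ s < n, SemiconjBy x (f (i + s)) (g (j + s))) :
    SemiconjBy x (descProd f i n) (descProd g j n) := by
  induction n with
  | zero => exact SemiconjBy.one_right x
  | succ n ih => exact (h n (by omega)).mul_right (ih fun s hs => h s (by omega))

end Products

variable [Algebra CoeffField R]

section Braid

variable {K A : Type*} [CommRing K] [Ring A] [Algebra K A] {a b : K} {x y : A}

/-- With `turn_mul_braid` for `x` and `y` exchanged in the hypotheses, this shows that a turnback
slides through two crossings: both sides of the relation are `y * x`. -/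
theorem braid_mul_turn (hab : a * b = 1) (hx : x * x = (-(a * a + b * b)) • x)
    (hxy : x * y * x = x) : (a • 1 + b • x) * (a • 1 + b • y) * x = y * x := by
  have e1 : (a • 1 + b • x) * (a • 1 + b • y) * x =
      (a * a) • x + (a * b) • (x * x) + (a * b) • (y * x) + (b * b) • (x * y * x) := by
    simp only [add_mul, mul_add, smul_mul_assoc, mul_smul_comm, one_mul, mul_one, smul_add,
      smul_smul]
    module
  rw [e1, hx, hxy, hab]
  module

theorem turn_mul_braid (hab : a * b = 1) (hy : y * y = (-(a * a + b * b)) • y)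
    (hxy : y * x * y = y) : y * ((a • 1 + b • x) * (a • 1 + b • y)) = y * x := by
  have e1 : y * ((a • 1 + b • x) * (a • 1 + b • y)) =
      (a * a) • y + (a * b) • (y * y) + (a * b) • (y * x) + (b * b) • (y * x * y) := by
    simp only [add_mul, mul_add, smul_mul_assoc, mul_smul_comm, one_mul, mul_one, smul_add,
      smul_smul, mul_assoc]
    module
  rw [e1, hy, hxy, hab]
  module

end Braid

theorem qPow_one_mul : qPow 1 * qPow (-1) = 1 := by rw [← qPow_add]; exact qPow_zero

/-- The turnback `⊃⊂` on the strands `i` and `i + 1`. -/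
def turn (cup cap : ℕ → R) (i : ℕ) : R := cup i * cap i

/-- The crossing of the strands `i` and `i + 1` whose overstrand runs from the upper left to the lower
right. -/
def crossOver (cup cap : ℕ → R) (i : ℕ) : R := qPow 1 • 1 + qPow (-1) • turn cup cap i

/-- The crossing of the strands `i` and `i + 1` whose overstrand runs from the lower left to the upper
right. -/
def crossUnder (cup cap : ℕ → R) (i : ℕ) : R := qPow 1 • turn cup cap i + qPow (-1) • 1

/-- The crossing of two cables: the strands `0, …, c - 1` go down over the `d` strands below them. -/
def crossing (cup cap : ℕ → R) (c : ℕ) : ℕ → R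
  | 0 => 1
  | d + 1 => ascProd (crossOver cup cap) d c * crossing cup cap c d

theorem semiconjBy_over {cup cap cup' cap' : ℕ → R} {x : R} {i j : ℕ}
    (h : SemiconjBy x (turn cup cap i) (turn cup' cap' j)) :
    SemiconjBy x (crossOver cup cap i) (crossOver cup' cap' j) := by
  have h' : x * turn cup cap i = turn cup' cap' j * x := h
  show x * _ = _ * x
  rw [crossOver, crossOver, mul_add, add_mul, mul_smul_comm, mul_smul_comm, h', smul_mul_assoc,
    smul_mul_assoc, mul_one, one_mul]

theorem semiconjBy_under {cup cap cup' cap' : ℕ → R} {x : R} {i j : ℕ}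
    (h : SemiconjBy x (turn cup cap i) (turn cup' cap' j)) :
    SemiconjBy x (crossUnder cup cap i) (crossUnder cup' cap' j) := by
  have h' : x * turn cup cap i = turn cup' cap' j * x := h
  show x * _ = _ * x
  rw [crossUnder, crossUnder, mul_add, add_mul, mul_smul_comm, mul_smul_comm, h', smul_mul_assoc,
    smul_mul_assoc, mul_one, one_mul]

namespace CupCapRelations

variable {cup cap : ℕ → R} (h : CupCapRelations cup cap)
include h

local notation "e" => turn cup cap
local notation "s" => crossOver cup cap
local notation "t" => crossUnder cup cap
local notation "X" => crossing cup cap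

theorem shift (a : ℕ) : CupCapRelations (fun i => cup (a + i)) (fun i => cap (a + i)) where
  cap_cup_self _ := h.cap_cup_self _
  cap_cup_succ _ := h.cap_cup_succ _
  cap_succ_cup _ := h.cap_succ_cup _
  cap_cup_of_le hij := h.cap_cup_of_le (Nat.add_le_add_left hij a)
  cap_cup_of_ge hij := h.cap_cup_of_ge (Nat.add_le_add_left hij a)
  cap_cap hij := h.cap_cap (Nat.add_le_add_left hij a)
  cup_cup hij := h.cup_cup (Nat.add_le_add_left hij a)

theorem commute_cap_turn {i k : ℕ} (hk : i + 2 ≤ k) : Commute (cap k) (e i) := by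
  obtain ⟨j, rfl⟩ := Nat.exists_eq_add_of_le' hk
  show cap (j + (i + 2)) * (cup i * cap i) = (cup i * cap i) * cap (j + (i + 2))
  rw [← add_assoc, ← mul_assoc, h.cap_cup_of_ge (by omega), mul_assoc, mul_assoc,
    h.cap_cap (by omega)]

theorem commute_cup_turn {i k : ℕ} (hk : i + 2 ≤ k) : Commute (cup k) (e i) := by
  obtain ⟨j, rfl⟩ := Nat.exists_eq_add_of_le' hk
  show cup (j + (i + 2)) * (cup i * cap i) = (cup i * cap i) * cup (j + (i + 2))
  rw [← add_assoc, ← mul_assoc, h.cup_cup (by omega), mul_assoc, mul_assoc,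
    h.cap_cup_of_le (by omega)]

theorem commute_turn_turn {i k : ℕ} (hk : i + 2 ≤ k) : Commute (e k) (e i) :=
  (h.commute_cup_turn hk).mul_left (h.commute_cap_turn hk)

theorem semiconjBy_cup_turn {i j : ℕ} (hij : i ≤ j) : SemiconjBy (cup i) (e j) (e (j + 2)) := by
  show cup i * (cup j * cap j) = (cup (j + 2) * cap (j + 2)) * cup i
  rw [← mul_assoc, ← h.cup_cup hij, mul_assoc, mul_assoc, h.cap_cup_of_ge hij]

theorem turn_mul_cup_self (i : ℕ) : e i * cup i = (-quantumInt 2) • cup i := by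
  rw [turn, mul_assoc, h.cap_cup_self, mul_smul_comm, mul_one]

theorem turn_mul_cup_succ (i : ℕ) : e i * cup (i + 1) = cup i := by
  rw [turn, mul_assoc, h.cap_cup_succ, mul_one]

theorem turn_succ_mul_cup (i : ℕ) : e (i + 1) * cup i = cup (i + 1) := by
  rw [turn, mul_assoc, h.cap_succ_cup, mul_one]

theorem cap_succ_mul_turn (i : ℕ) : cap (i + 1) * e i = cap i := by
  rw [turn, ← mul_assoc, h.cap_succ_cup, one_mul]

/-- Removing a curl. -/
theorem over_mul_cup_self (i : ℕ) : s i * cup i = (-qPow (-3)) • cup i := by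
  rw [crossOver, add_mul, smul_mul_assoc, smul_mul_assoc, h.turn_mul_cup_self, one_mul, smul_smul,
    ← add_smul, quantumInt_two, mul_neg, mul_add, ← qPow_add, ← qPow_add]
  norm_num

/-- A strand that crosses one leg of an arc is moved across the arc to its other leg. -/
theorem over_mul_cup_succ (i : ℕ) : s i * cup (i + 1) = t (i + 1) * cup i := by
  rw [crossOver, crossUnder, add_mul, add_mul]
  simp only [smul_mul_assoc, h.turn_mul_cup_succ, h.turn_succ_mul_cup, one_mul]

theorem over_succ_mul_cup (i : ℕ) : s (i + 1) * cup i = t i * cup (i + 1) := by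
  rw [crossOver, crossUnder, add_mul, add_mul]
  simp only [smul_mul_assoc, h.turn_mul_cup_succ, h.turn_succ_mul_cup, one_mul]

theorem turn_mul_self (i : ℕ) : e i * e i = (-(qPow 1 * qPow 1 + qPow (-1) * qPow (-1))) • e i := by
  nth_rewrite 2 [turn]
  rw [← mul_assoc, h.turn_mul_cup_self, smul_mul_assoc, quantumInt_two, ← qPow_add,
    ← qPow_add]
  rfl

theorem turn_mul_turn_succ_mul_turn (i : ℕ) : e i * e (i + 1) * e i = e i := by
  rw [mul_assoc]
  nth_rewrite 3 [turn]
  rw [← mul_assoc (e (i + 1)), h.turn_succ_mul_cup, ← mul_assoc, h.turn_mul_cup_succ, turn]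

theorem turn_succ_mul_turn_mul_turn_succ (i : ℕ) : e (i + 1) * e i * e (i + 1) = e (i + 1) := by
  rw [mul_assoc]
  nth_rewrite 3 [turn]
  rw [← mul_assoc (e i), h.turn_mul_cup_succ, ← mul_assoc, h.turn_succ_mul_cup, turn]

theorem semiconjBy_over_over_succ (i : ℕ) : SemiconjBy (s i * s (i + 1)) (e i) (e (i + 1)) :=
  (braid_mul_turn qPow_one_mul (h.turn_mul_self i) (h.turn_mul_turn_succ_mul_turn i)).trans
    (turn_mul_braid qPow_one_mul (h.turn_mul_self (i + 1)) (h.turn_succ_mul_turn_mul_turn_succ i)).symm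

theorem semiconjBy_over_succ_over (i : ℕ) : SemiconjBy (s (i + 1) * s i) (e (i + 1)) (e i) :=
  (braid_mul_turn qPow_one_mul (h.turn_mul_self (i + 1)) (h.turn_succ_mul_turn_mul_turn_succ i)).trans
    (turn_mul_braid qPow_one_mul (h.turn_mul_self i) (h.turn_mul_turn_succ_mul_turn i)).symm

/-! ### Crossings of cables -/

theorem commute_over_over {i k : ℕ} (hk : i + 2 ≤ k) : Commute (s k) (s i) :=
  semiconjBy_over (Commute.symm (semiconjBy_over (h.commute_turn_turn hk).symm))

theorem semiconjBy_ascProd_turn (i : ℕ) {n k : ℕ} (hk : k + 2 ≤ n) :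
    SemiconjBy (ascProd s i n) (e (i + k)) (e (i + k + 1)) := by
  obtain ⟨n, rfl⟩ := Nat.exists_eq_add_of_le hk
  induction n with
  | zero =>
    rw [add_zero, ascProd, ascProd, mul_assoc]
    refine SemiconjBy.mul_left ?_ (h.semiconjBy_over_over_succ (i + k))
    refine Commute.symm (SemiconjBy.ascProd_right fun r hr => semiconjBy_over ?_)
    exact h.commute_turn_turn (by omega)
  | succ n ih =>
    rw [← add_assoc, ascProd]
    refine SemiconjBy.mul_left (ih (by omega)) ?_
    exact Commute.symm (semiconjBy_over (h.commute_turn_turn (by omega)).symm)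

theorem semiconjBy_descProd_turn (i : ℕ) {n k : ℕ} (hk : k + 2 ≤ n) :
    SemiconjBy (descProd s i n) (e (i + k + 1)) (e (i + k)) := by
  obtain ⟨n, rfl⟩ := Nat.exists_eq_add_of_le hk
  induction n with
  | zero =>
    rw [add_zero, descProd, descProd, ← mul_assoc]
    refine SemiconjBy.mul_left (h.semiconjBy_over_succ_over (i + k)) ?_
    refine Commute.symm (SemiconjBy.descProd_right fun r hr => semiconjBy_over ?_)
    exact h.commute_turn_turn (by omega)
  | succ n ih =>
    rw [← add_assoc, descProd]
    refine SemiconjBy.mul_left ?_ (ih (by omega))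
    exact Commute.symm (semiconjBy_over (h.commute_turn_turn (by omega)).symm)

omit h in
theorem commute_crossing {x : R} (c d : ℕ) (hx : ∀ j, j + 1 < c + d → Commute x (s j)) :
    Commute x (X c d) := by
  induction d with
  | zero => exact Commute.one_right x
  | succ d ih =>
    exact Commute.mul_right (SemiconjBy.ascProd_right fun r hr => hx _ (by omega))
      (ih fun j hj => hx j (by omega))

/-- The crossings on the lowest strand of the upper cable can be split off at the left. -/
theorem crossing_succ_left (c d : ℕ) : X (c + 1) d = X c d * descProd s c d := by
  induction d with
  | zero => simp [crossing, descProd]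
  | succ d ih =>
    have hc : Commute (s (d + c)) (X c d) :=
      commute_crossing c d fun j hj => h.commute_over_over (by omega)
    rw [crossing, ih, ascProd, crossing, descProd, mul_assoc, ← mul_assoc (s (d + c)), hc.eq,
      add_comm d c]
    simp only [mul_assoc]

/-- A turnback on the upper cable slides through the crossing. -/
theorem crossing_semiconjBy_upper {c k : ℕ} (d : ℕ) (hk : k + 2 ≤ c) :
    SemiconjBy (X c d) (e k) (e (d + k)) := by
  induction d with
  | zero => rw [zero_add]; exact SemiconjBy.one_left _
  | succ d ih =>
    rw [add_right_comm]
    exact SemiconjBy.mul_left (h.semiconjBy_ascProd_turn d hk) ih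

/-- A turnback on the lower cable slides through the crossing. -/
theorem crossing_semiconjBy_lower (c : ℕ) {d k : ℕ} (hk : k + 2 ≤ d) :
    SemiconjBy (X c d) (e (c + k)) (e k) := by
  induction c with
  | zero =>
    have : X 0 d = 1 := by
      clear hk
      induction d with
      | zero => rfl
      | succ d ih => rw [crossing, ih, ascProd, one_mul]
    rw [this, zero_add]; exact SemiconjBy.one_left _
  | succ c ih =>
    rw [h.crossing_succ_left, add_right_comm]
    exact SemiconjBy.mul_left ih (h.semiconjBy_descProd_turn c hk)

end CupCapRelations

end

section

variable {R : Type*} [Ring R] [Algebra CoeffField R]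

/-! ### Clasps -/

/-- The clasp of color `n` on the strands `i, …, i + n - 1`. -/
def claspElt (cup cap : ℕ → R) (i : ℕ) : ℕ → R
  | 0 => 1
  | 1 => 1
  | n + 2 => claspElt cup cap i (n + 1) +
      (quantumInt (n + 1) / quantumInt (n + 2)) •
        (claspElt cup cap i (n + 1) * turn cup cap (i + n) * claspElt cup cap i (n + 1))

theorem commute_claspElt {cup cap : ℕ → R} {x : R} (i n : ℕ)
    (hx : ∀ j, j + 2 ≤ n → Commute x (turn cup cap (i + j))) :
    Commute x (claspElt cup cap i n) := by
  match n, hx with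
  | 0, _ => exact Commute.one_right x
  | 1, _ => exact Commute.one_right x
  | n + 2, hx =>
    have ih := commute_claspElt i (n + 1) fun j hj => hx j (by omega)
    exact ih.add_right (((ih.mul_right (hx n (by omega))).mul_right ih).smul_right _)

/-- The properties of the clasp of color `n + 1` that are proved by a joint induction: the inductive
step for annihilation needs the partial trace, and that for the partial trace needs idempotency. -/
structure IsClasp (cup cap : ℕ → R) (i n : ℕ) : Prop where
  mul_self : claspElt cup cap i (n + 1) * claspElt cup cap i (n + 1) = claspElt cup cap i (n + 1)
  cap_mul : ∀ j < n, cap (i + j) * claspElt cup cap i (n + 1) = 0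
  mul_cup : ∀ j < n, claspElt cup cap i (n + 1) * cup (i + j) = 0
  pred_mul : claspElt cup cap i n * claspElt cup cap i (n + 1) = claspElt cup cap i (n + 1)
  mul_pred : claspElt cup cap i (n + 1) * claspElt cup cap i n = claspElt cup cap i (n + 1)
  partial_trace : cap (i + n) * claspElt cup cap i (n + 1) * cup (i + n) =
    (-(quantumInt (n + 2) / quantumInt (n + 1))) • claspElt cup cap i n

namespace CupCapRelations

variable {cup cap : ℕ → R} (h : CupCapRelations cup cap)
include h

local notation "e" => turn cup cap
local notation "P" => claspElt cup cap

theorem isClasp (i n : ℕ) : IsClasp cup cap i n := by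
  induction n with
  | zero =>
    have e1 : P i (0 + 1) = 1 := rfl
    have e0 : P i 0 = 1 := rfl
    refine ⟨?_, fun j hj => absurd hj (by omega), fun j hj => absurd hj (by omega), ?_, ?_, ?_⟩
    · rw [e1, one_mul]
    · rw [e1, e0, one_mul]
    · rw [e1, e0, one_mul]
    · rw [e1, e0, mul_one, h.cap_cup_self]
      simp [quantumInt_one]
  | succ n ih =>
    set Q := P i (n + 1) with hQ
    set c := quantumInt ((n : ℤ) + 1) / quantumInt ((n : ℤ) + 2) with hc
    have hne1 : quantumInt ((n : ℤ) + 1) ≠ 0 := quantumInt_ne_zero (by omega)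
    have hne2 : quantumInt ((n : ℤ) + 2) ≠ 0 := quantumInt_ne_zero (by omega)
    have hP : P i (n + 1 + 1) = Q + c • (Q * e (i + n) * Q) := rfl
    have hcap : Commute (cap (i + n)) (P i n) :=
      commute_claspElt i n fun j hj => h.commute_cap_turn (by omega)
    have hcup : Commute (cup (i + n)) (P i n) :=
      commute_claspElt i n fun j hj => h.commute_cup_turn (by omega)
    have hcap' : Commute (cap (i + n + 1)) Q :=
      commute_claspElt i (n + 1) fun j hj => h.commute_cap_turn (by omega)
    have hcup' : Commute (cup (i + n + 1)) Q :=
      commute_claspElt i (n + 1) fun j hj => h.commute_cup_turn (by omega)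
    have hcc : c * (-(quantumInt ((n : ℤ) + 2) / quantumInt ((n : ℤ) + 1))) = -1 := by
      rw [hc]; field_simp
    have hQQ : Q * Q = Q := ih.mul_self
    have hcap_mul : ∀ j < n + 1, cap (i + j) * P i (n + 1 + 1) = 0 := by
      intro j hj
      rw [hP, mul_add, mul_smul_comm]
      rcases Nat.lt_succ_iff_lt_or_eq.1 hj with hj | rfl
      · rw [mul_assoc Q, ← mul_assoc, ih.cap_mul j hj, zero_mul, smul_zero, add_zero]
      · have : cap (i + j) * (Q * e (i + j) * Q) =
            (cap (i + j) * Q * cup (i + j)) * (cap (i + j) * Q) := by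
          simp only [turn, mul_assoc]
        rw [this, ih.partial_trace, smul_mul_assoc, ← mul_assoc, ← hcap.eq, mul_assoc, ih.pred_mul,
          smul_smul, hcc, neg_one_smul, add_neg_cancel]
    have hmul_cup : ∀ j < n + 1, P i (n + 1 + 1) * cup (i + j) = 0 := by
      intro j hj
      rw [hP, add_mul, smul_mul_assoc]
      rcases Nat.lt_succ_iff_lt_or_eq.1 hj with hj | rfl
      · rw [mul_assoc _ Q, ih.mul_cup j hj, mul_zero, smul_zero, add_zero]
      · have : Q * e (i + j) * Q * cup (i + j) =
            (Q * cup (i + j)) * (cap (i + j) * Q * cup (i + j)) := by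
          simp only [turn, mul_assoc]
        rw [this, ih.partial_trace, mul_smul_comm, mul_assoc, hcup.eq, ← mul_assoc, ih.mul_pred,
          smul_smul, hcc, neg_one_smul, add_neg_cancel]
    have hpred : Q * P i (n + 1 + 1) = P i (n + 1 + 1) := by
      rw [hP, mul_add, mul_smul_comm, mul_assoc Q, ← mul_assoc Q Q, hQQ]
    have hpred' : P i (n + 1 + 1) * Q = P i (n + 1 + 1) := by
      rw [hP, add_mul, smul_mul_assoc, mul_assoc _ Q Q, hQQ]
    refine ⟨?_, hcap_mul, hmul_cup, hpred, hpred', ?_⟩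
    · nth_rewrite 2 [hP]
      rw [mul_add, hpred', mul_smul_comm, turn]
      simp only [← mul_assoc]
      rw [hpred', hmul_cup n (by omega), zero_mul, zero_mul, smul_zero, add_zero]
    · rw [← add_assoc]
      have e1 : cap (i + n + 1) * Q * cup (i + n + 1) = (-quantumInt 2) • Q := by
        rw [hcap'.eq, mul_assoc, h.cap_cup_self, mul_smul_comm, mul_one]
      have e2 : cap (i + n + 1) * (Q * e (i + n) * Q) * cup (i + n + 1) = Q := by
        have : cap (i + n + 1) * (Q * e (i + n) * Q) * cup (i + n + 1) =
          (cap (i + n + 1) * Q) * e (i + n) * (Q * cup (i + n + 1)) := by simp only [mul_assoc]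
        rw [this, hcap'.eq, ← hcup'.eq, mul_assoc Q, h.cap_succ_mul_turn, mul_assoc,
          ← mul_assoc (cap _), h.cap_cup_succ, one_mul, hQQ]
      rw [hP, mul_add, add_mul, e1, mul_smul_comm, smul_mul_assoc, e2, ← add_smul]
      congr 1
      have := quantumInt_two_mul ((n : ℤ) + 2)
      push_cast
      rw [show (n : ℤ) + 1 + 2 = n + 2 + 1 by ring, show (n : ℤ) + 1 + 1 = n + 2 by ring, hc]
      rw [show (n : ℤ) + 2 - 1 = n + 1 by ring] at this
      field_simp
      linear_combination -this

theorem cap_mul_claspElt {i n j : ℕ} (hj : j + 1 < n) : cap (i + j) * P i n = 0 := by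
  obtain ⟨n, rfl⟩ := Nat.exists_eq_succ_of_ne_zero (show n ≠ 0 by omega)
  exact (h.isClasp i n).cap_mul j (by omega)

theorem claspElt_mul_cup {i n j : ℕ} (hj : j + 1 < n) : P i n * cup (i + j) = 0 := by
  obtain ⟨n, rfl⟩ := Nat.exists_eq_succ_of_ne_zero (show n ≠ 0 by omega)
  exact (h.isClasp i n).mul_cup j (by omega)

theorem commute_claspElt_claspElt (n : ℕ) : Commute (P n n) (P 0 n) :=
  commute_claspElt 0 n fun _ _ => Commute.symm <| commute_claspElt n n fun _ _ =>
    (h.commute_turn_turn (by omega)).symm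

end CupCapRelations

/-! ### Expansion of a crossing between two pairs of clasps -/

/-- `v` is killed by the caps on two neighbouring strands among the first `c + d` ones, unless these
are the last of the upper `c` and the first of the lower `d` strands. -/
def CapKilled (cap : ℕ → R) (c d : ℕ) (v : R) : Prop :=
  ∀ i, i + 1 ≠ c → i + 1 < c + d → cap i * v = 0

/-- `φ` kills the cups on two neighbouring strands among the first `c + d` ones, unless these are the
last of the upper `c` and the first of the lower `d` strands. -/
def KillsCup (cup : ℕ → R) (c d : ℕ) (φ : R) : Prop :=
  ∀ i, i + 1 ≠ c → i + 1 < c + d → φ * cup i = 0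

/-- `j` nested arcs `⊃` below `k` strands. -/
def nestedCapElt (cap : ℕ → R) (k : ℕ) : ℕ → R
  | 0 => 1
  | j + 1 => nestedCapElt cap k j * cap (k + j)

/-- `j` nested arcs `⊂` below `k` strands. -/
def nestedCupElt (cup : ℕ → R) (k : ℕ) : ℕ → R
  | 0 => 1
  | j + 1 => cup (k + j) * nestedCupElt cup k j

namespace CupCapRelations

variable {cup cap : ℕ → R} (h : CupCapRelations cup cap)
include h

local notation "e" => turn cup cap
local notation "s" => crossOver cup cap
local notation "t" => crossUnder cup cap
local notation "X" => crossing cup cap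

theorem capKilled_cap_mul {c d : ℕ} {v : R} (hv : CapKilled cap (c + 1) (d + 1) v) :
    CapKilled cap c d (cap c * v) := by
  intro i hi hi'
  rcases lt_or_ge i c with hic | hic
  · obtain ⟨j, rfl⟩ := Nat.exists_eq_add_of_le' (show 2 ≤ c by omega)
    rw [← mul_assoc, h.cap_cap (by omega), mul_assoc, hv i (by omega) (by omega), mul_zero]
  · rw [← mul_assoc, ← h.cap_cap hic, mul_assoc, hv (i + 2) (by omega) (by omega), mul_zero]

theorem killsCup_mul_cup {c d : ℕ} {φ : R} (hφ : KillsCup cup (c + 1) (d + 1) φ) :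
    KillsCup cup c d (φ * cup c) := by
  intro i hi hi'
  rcases lt_or_ge i c with hic | hic
  · obtain ⟨j, rfl⟩ := Nat.exists_eq_add_of_le' (show 2 ≤ c by omega)
    rw [mul_assoc, h.cup_cup (by omega), ← mul_assoc, hφ i (by omega) (by omega), zero_mul]
  · rw [mul_assoc, ← h.cup_cup hic, ← mul_assoc, hφ (i + 2) (by omega) (by omega), zero_mul]

omit h in
theorem crossOver_mul_of_cap {i : ℕ} {v : R} (hv : cap i * v = 0) : s i * v = qPow 1 • v := by
  rw [crossOver, turn, add_mul, smul_mul_assoc, one_mul, smul_mul_assoc, mul_assoc, hv, mul_zero,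
    smul_zero, add_zero]

omit h in
theorem mul_crossOver_of_cup {i : ℕ} {φ : R} (hφ : φ * cup i = 0) : φ * s i = qPow 1 • φ := by
  rw [crossOver, turn, mul_add, mul_smul_comm, mul_one, mul_smul_comm, ← mul_assoc, hφ, zero_mul,
    smul_zero, add_zero]

omit h in
theorem mul_crossUnder_of_cup {i : ℕ} {φ : R} (hφ : φ * cup i = 0) :
    φ * t i = qPow (-1) • φ := by
  rw [crossUnder, turn, mul_add, mul_smul_comm, mul_smul_comm, ← mul_assoc, hφ, zero_mul,
    smul_zero, zero_add, mul_one]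

omit h in
theorem ascProd_mul_of_cap {i n : ℕ} {v : R} (hv : ∀ r < n, cap (i + r) * v = 0) :
    ascProd s i n * v = qPow n • v := by
  induction n with
  | zero => simp [ascProd, qPow_zero]
  | succ n ih =>
    rw [ascProd, mul_assoc, crossOver_mul_of_cap (hv n (by omega)), mul_smul_comm,
      ih fun r hr => hv r (by omega), smul_smul, ← qPow_add]
    congr 2; push_cast; ring

omit h in
theorem mul_ascProd_of_cup {i n : ℕ} {φ : R} (hφ : ∀ r < n, φ * cup (i + r) = 0) :
    φ * ascProd s i n = qPow n • φ := by
  induction n with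
  | zero => simp [ascProd, qPow_zero]
  | succ n ih =>
    rw [ascProd, ← mul_assoc, ih fun r hr => hφ r (by omega), smul_mul_assoc,
      mul_crossOver_of_cup (hφ n (by omega)), smul_smul, ← qPow_add]
    congr 2

omit h in
theorem mul_ascProd_crossUnder_of_cup {i n : ℕ} {φ : R} (hφ : ∀ r < n, φ * cup (i + r) = 0) :
    φ * ascProd t i n = qPow (-n) • φ := by
  induction n with
  | zero => simp [ascProd, qPow_zero]
  | succ n ih =>
    rw [ascProd, ← mul_assoc, ih fun r hr => hφ r (by omega), smul_mul_assoc,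
      mul_crossUnder_of_cup (hφ n (by omega)), smul_smul, ← qPow_add]
    congr 2; push_cast; ring

omit h in
theorem mul_descProd_crossUnder_of_cup {i n : ℕ} {φ : R} (hφ : ∀ r < n, φ * cup (i + r) = 0) :
    φ * descProd t i n = qPow (-n) • φ := by
  induction n with
  | zero => simp [descProd, qPow_zero]
  | succ n ih =>
    rw [descProd, ← mul_assoc, mul_crossUnder_of_cup (hφ n (by omega)), smul_mul_assoc,
      ih fun r hr => hφ r (by omega), smul_smul, ← qPow_add]
    congr 2; push_cast; ring

/-- The crossings of one strand with `x - c` others, next to a cup at the end: the only smoothing that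
survives between `φ` and `v` is the one in which the cup is moved to the position `p` where `φ` does
not kill it. -/
theorem ascProd_mul_cup_mul {c d x p : ℕ} {φ v : R} (hφ : KillsCup cup (p + 1) d φ) (hc : c ≤ p)
    (hpx : p ≤ x) (hx : x + 1 < p + 1 + d) (hv : ∀ j, c ≤ j → j + 1 < x → cap j * v = 0) :
    φ * ascProd s c (x - c) * cup x * v = qPow (2 * p - c - x) • (φ * cup p * v) := by
  obtain ⟨n, rfl⟩ := Nat.exists_eq_add_of_le (hc.trans hpx)
  rw [Nat.add_sub_cancel_left]
  induction n with
  | zero =>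
    obtain rfl : p = c := by omega
    simp [ascProd, show 2 * (p : ℤ) - p - p = 0 by ring, qPow_zero]
  | succ n ih =>
    have hcomm : Commute (cup (c + n + 1)) (ascProd s c n) :=
      SemiconjBy.ascProd_right fun r hr => semiconjBy_over (h.commute_cup_turn (by omega))
    have e1 : φ * ascProd s c (n + 1) * cup (c + (n + 1)) * v =
        qPow (n + 1) • (φ * cup (c + n + 1) * v) +
          qPow (-1) • (φ * ascProd s c n * cup (c + n) * v) := by
      rw [ascProd, ← add_assoc, mul_assoc, mul_assoc, mul_assoc, ← mul_assoc (s _), crossOver,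
        add_mul, smul_mul_assoc, smul_mul_assoc, one_mul, h.turn_mul_cup_succ, add_mul, mul_add,
        mul_add, smul_mul_assoc, smul_mul_assoc, mul_smul_comm, mul_smul_comm, mul_smul_comm,
        mul_smul_comm, ← mul_assoc (ascProd s c n), ← hcomm.eq, mul_assoc (cup _),
        ascProd_mul_of_cap fun r hr => hv _ (by omega) (by omega), mul_smul_comm, mul_smul_comm,
        smul_smul, ← qPow_add]
      simp only [mul_assoc]
      rw [add_comm 1]
    rw [e1]
    rcases Nat.lt_or_ge (c + n) p with hp | hp
    · obtain rfl : p = c + n + 1 := by omega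
      have hφ' : φ * ascProd s c n = qPow n • φ := mul_ascProd_of_cup fun r hr =>
        hφ _ (by omega) (by omega)
      rw [hφ', smul_mul_assoc, hφ (c + n) (by omega) (by omega), smul_zero, zero_mul, smul_zero,
        add_zero]
      congr 2; push_cast; ring
    · rw [hφ (c + n + 1) (by omega) (by omega), zero_mul, smul_zero, zero_add,
        ih hp (by omega) fun j hj hj' => hv j hj (by omega), smul_smul, ← qPow_add]
      congr 2; push_cast; ring

/-- A strand passes over `d` strands and is then joined to the next one. Sliding this arc to the left
end moves the crossings to its other leg, where `v` absorbs them. -/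
theorem cap_mul_descProd_mul {c d : ℕ} {v : R} (hv : ∀ r < d, cap (c + r + 1) * v = 0) :
    cap (c + d) * descProd s c d * v = qPow (-d) • (cap c * v) := by
  induction d with
  | zero => simp [descProd, qPow_zero]
  | succ d ih =>
    have hc : Commute (cap (c + d + 1)) (descProd s c d) :=
      SemiconjBy.descProd_right fun r hr => semiconjBy_over (h.commute_cap_turn (by omega))
    rw [← add_assoc, descProd, ← mul_assoc, crossOver, mul_add, mul_smul_comm, mul_smul_comm,
      mul_one, h.cap_succ_mul_turn, add_mul, add_mul, smul_mul_assoc, smul_mul_assoc, smul_mul_assoc,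
      smul_mul_assoc, ih fun r hr => hv r (by omega), hc.eq, mul_assoc, hv d (by omega), mul_zero,
      smul_zero, zero_add, smul_smul, ← qPow_add]
    congr 2; push_cast; ring

/-- The recursion for the crossing of two cables: the last strand of the lower cable either runs
straight through or turns back. -/
theorem mul_crossing_mul {c d d' : ℕ} {φ v : R} (hφ : KillsCup cup (c + 1) d' φ)
    (hv : CapKilled cap (c + 1) (d + 1) v) (hd : d ≤ c) (hd' : d + 1 ≤ d') :
    φ * X (c + 1) (d + 1) * v = qPow (c + 1) • (φ * X (c + 1) d * v) +
      qPow (c - 3 * d - 1) • (φ * cup c * X c d * (cap c * v)) := by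
  have hcap : ∀ r < c, cap (d + r) * (X (c + 1) d * v) = 0 := by
    intro r hr
    rw [← h.cap_succ_mul_turn, mul_assoc, ← mul_assoc (e _),
      ← (h.crossing_semiconjBy_upper d (show r + 2 ≤ c + 1 by omega)).eq, mul_assoc (X _ _), turn,
      mul_assoc, hv r (by omega) (by omega), mul_zero, mul_zero, mul_zero]
  have hturn : cap (d + c) * (X (c + 1) d * v) = qPow (-d) • (X c d * (cap c * v)) := by
    have hcomm : Commute (cap (c + d)) (X c d) :=
      commute_crossing c d fun j hj => semiconjBy_over (h.commute_cap_turn (by omega))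
    rw [h.crossing_succ_left, mul_assoc, ← mul_assoc, add_comm d, hcomm.eq, mul_assoc,
      ← mul_assoc (cap _), h.cap_mul_descProd_mul fun r hr => hv _ (by omega) (by omega),
      mul_smul_comm]
  have hpull : φ * ascProd s d c * cup (d + c) * (cap (d + c) * (X (c + 1) d * v)) =
      qPow (2 * c - d - (d + c : ℕ)) • (φ * cup c * (cap (d + c) * (X (c + 1) d * v))) := by
    have := h.ascProd_mul_cup_mul (v := cap (d + c) * (X (c + 1) d * v)) hφ hd
      (show c ≤ d + c by omega) (by omega) (by
        intro j hj hj'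
        obtain ⟨x, hx⟩ := Nat.exists_eq_add_of_le' (show 2 ≤ d + c by omega)
        obtain ⟨r, rfl⟩ := Nat.exists_eq_add_of_le hj
        rw [hx, ← mul_assoc, h.cap_cap (by omega), mul_assoc, hcap r (by omega), mul_zero])
    rwa [Nat.add_sub_cancel_left] at this
  have e1 : φ * X (c + 1) (d + 1) * v =
      qPow 1 • (φ * (ascProd s d c * (X (c + 1) d * v))) +
        qPow (-1) • (φ * ascProd s d c * cup (d + c) * (cap (d + c) * (X (c + 1) d * v))) := by
    rw [crossing, ascProd, crossOver, turn]
    simp only [mul_add, add_mul, mul_smul_comm, smul_mul_assoc, mul_one, mul_assoc]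
  rw [e1, ascProd_mul_of_cap hcap, hpull, hturn, mul_smul_comm, mul_smul_comm, smul_smul,
    smul_smul, smul_smul]
  simp only [← qPow_add, mul_assoc]
  congr 3 <;> (push_cast; ring)

/-- The expansion of the crossing of two cables between clasps; `u` is the number of turnbacks. -/
theorem mul_crossing_mul_eq_sum {c d d' : ℕ} {φ v : R} (hφ : KillsCup cup c d' φ)
    (hv : CapKilled cap c d v) (hd : d ≤ c) (hd' : d ≤ d') :
    φ * X c d * v = ∑ u ∈ Finset.range (d + 1),
      (qPow (c * d + 2 * u * (u - 2 * d)) * gaussBinom d u) •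
        (φ * nestedCupElt cup (c - u) u * nestedCapElt cap (c - u) u * v) := by
  induction d generalizing c d' φ v with
  | zero => simp [crossing, nestedCupElt, nestedCapElt, gaussBinom, qPow_zero]
  | succ d ih =>
    obtain ⟨c, rfl⟩ := Nat.exists_eq_succ_of_ne_zero (show c ≠ 0 by omega)
    obtain ⟨d', rfl⟩ := Nat.exists_eq_succ_of_ne_zero (show d' ≠ 0 by omega)
    have ih1 := ih hφ (fun i hi hi' => hv i hi (by omega)) (by omega) (by omega)
    have ih2 := ih (h.killsCup_mul_cup hφ) (h.capKilled_cap_mul hv) (by omega) (by omega)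
    rw [h.mul_crossing_mul hφ hv (by omega) hd', ih2, Finset.sum_range_succ' _ (d + 1)]
    -- The vanishing of `gaussBinom d (d + 1)` extends the first sum to the range of the goal.
    have hz := Finset.sum_range_succ (fun u : ℕ =>
      (qPow ((c + 1 : ℕ) * d + 2 * u * (u - 2 * d)) * gaussBinom d u) •
        (φ * nestedCupElt cup (c + 1 - u) u * nestedCapElt cap (c + 1 - u) u * v)) (d + 1)
    rw [gaussBinom_eq_zero (Nat.lt_succ_self d), mul_zero, zero_smul, add_zero,
      Finset.sum_range_succ'] at hz
    rw [Nat.succ_eq_add_one] at ih1 ⊢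
    rw [ih1, ← hz, smul_add, add_right_comm, Finset.smul_sum, Finset.smul_sum,
      ← Finset.sum_add_distrib]
    congr 1
    · refine Finset.sum_congr rfl fun u hu => ?_
      rw [Finset.mem_range] at hu
      have e1 : c + 1 - (u + 1) = c - u := by omega
      have e2 : c - u + u = c := by omega
      simp only [e1, nestedCupElt, nestedCapElt, e2, gaussBinom, ← mul_assoc]
      rw [smul_smul, smul_smul, ← add_smul]
      congr 1
      rw [q, qPow_pow, ← mul_assoc, ← mul_assoc, mul_add, ← mul_assoc]
      simp only [← qPow_add]
      congr 3 <;> (push_cast; ring)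
    · rw [smul_smul, ← mul_assoc, ← qPow_add]
      cases d <;> simp only [gaussBinom] <;> congr 3 <;> (push_cast; ring)

/-! ### A half twist next to turnbacks -/

theorem semiconjBy_ascProd_crossUnder (i : ℕ) {n k : ℕ} (hk : k < n) :
    SemiconjBy (ascProd s i (n + 1)) (t (i + k)) (t (i + 1 + k)) := by
  rw [add_right_comm]
  exact semiconjBy_under (h.semiconjBy_ascProd_turn i (by omega))

/-- An arc between the two cables of a crossing is slid through it. After the curl has been removed,
the arc lies between the overstrands and the understrands of the remaining crossing, and it ends up
on the other side, where its legs cross the other strands. -/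
theorem crossing_mul_cup (c d : ℕ) : X (c + 1) (d + 1) * cup c =
    (-qPow (-3)) • (ascProd t 0 d * descProd t (d + 1) c * cup d * X c d) := by
  induction d with
  | zero =>
    -- An arc whose upper leg crosses under `c` strands is moved across them to the top; there its
    -- lower leg crosses them.
    have key : ascProd s 0 c * cup c = descProd t 1 c * cup 0 := by
      induction c with
      | zero => rfl
      | succ c ih =>
        have hcomm : Commute (t (c + 1)) (ascProd s 0 c) :=
          SemiconjBy.ascProd_right fun r hr => semiconjBy_over
            (Commute.symm (semiconjBy_under (h.commute_turn_turn (by omega)).symm))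
        rw [ascProd, zero_add, mul_assoc, h.over_mul_cup_succ, ← mul_assoc, ← hcomm.eq, mul_assoc,
          ih, ← mul_assoc, descProd, add_comm 1 c]
    simp only [crossing, ascProd, zero_add, mul_one, one_mul]
    rw [mul_assoc, h.over_mul_cup_self, mul_smul_comm, key]
  | succ d ih =>
    have h1 : Commute (ascProd t 0 d) (ascProd s (d + 1) (c + 1)) :=
      SemiconjBy.ascProd_right fun r hr => semiconjBy_over
        (Commute.symm (SemiconjBy.ascProd_right fun r' hr' =>
          semiconjBy_under (h.commute_turn_turn (by omega))))
    have h2 : SemiconjBy (ascProd s (d + 1) (c + 1)) (descProd t (d + 1) c)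
        (descProd t (d + 1 + 1) c) :=
      SemiconjBy.descProd_right fun r hr => h.semiconjBy_ascProd_crossUnder (d + 1) hr
    have h3 : SemiconjBy (cup d) (ascProd s d c) (ascProd s (d + 1 + 1) c) :=
      SemiconjBy.ascProd_right fun r hr => semiconjBy_over (by
        have := h.semiconjBy_cup_turn (show d ≤ d + r by omega)
        rwa [show d + r + 2 = d + 1 + 1 + r by ring] at this)
    have h4 : Commute (t d) (descProd t (d + 1 + 1) c) :=
      SemiconjBy.descProd_right fun r hr => semiconjBy_under
        (Commute.symm (semiconjBy_under (h.commute_turn_turn (by omega))))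
    rw [crossing, mul_assoc, ih, mul_smul_comm]
    congr 1
    calc ascProd s (d + 1) (c + 1) * (ascProd t 0 d * descProd t (d + 1) c * cup d * X c d)
        = ascProd s (d + 1) (c + 1) * ascProd t 0 d * descProd t (d + 1) c * cup d * X c d := by
          simp only [mul_assoc]
      _ = ascProd t 0 d * (ascProd s (d + 1) (c + 1) * descProd t (d + 1) c) * cup d * X c d := by
          rw [← h1.eq]; simp only [mul_assoc]
      _ = ascProd t 0 d * descProd t (d + 1 + 1) c * s (d + 1) *
            (ascProd s (d + 1 + 1) c * cup d) * X c d := by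
          rw [h2.eq, ascProd_succ_left]; simp only [mul_assoc]
      _ = ascProd t 0 d * descProd t (d + 1 + 1) c * (s (d + 1) * cup d) * ascProd s d c *
            X c d := by
          rw [← h3.eq]; simp only [mul_assoc]
      _ = ascProd t 0 d * (descProd t (d + 1 + 1) c * t d) * cup (d + 1) * ascProd s d c *
            X c d := by
          rw [h.over_succ_mul_cup]; simp only [mul_assoc]
      _ = ascProd t 0 (d + 1) * descProd t (d + 1 + 1) c * cup (d + 1) * X c (d + 1) := by
          rw [← h4.eq, ascProd, crossing, zero_add]; simp only [mul_assoc]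

theorem mul_crossing_mul_cup {n : ℕ} {φ : R} (hφ : KillsCup cup (n + 1) (n + 1) φ) :
    φ * X (n + 1) (n + 1) * cup n = (-qPow (-(2 * n + 3))) • (φ * cup n * X n n) := by
  rw [mul_assoc, h.crossing_mul_cup, mul_smul_comm]
  simp only [← mul_assoc]
  rw [mul_ascProd_crossUnder_of_cup fun r hr => hφ _ (by omega) (by omega), smul_mul_assoc,
    mul_descProd_crossUnder_of_cup fun r hr => hφ _ (by omega) (by omega)]
  simp only [smul_mul_assoc, smul_smul, neg_mul, ← qPow_add]
  congr 3; ring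

theorem mul_crossing_mul_nestedCupElt {k j : ℕ} {φ : R}
    (hφ : KillsCup cup (k + j) (k + j) φ) :
    φ * X (k + j) (k + j) * nestedCupElt cup k j =
      ((-1) ^ j * qPow (-(j * (2 * k + j + 2)))) • (φ * nestedCupElt cup k j * X k k) := by
  induction j generalizing φ with
  | zero => simp [nestedCupElt, qPow_zero]
  | succ j ih =>
    rw [← add_assoc] at hφ ⊢
    rw [nestedCupElt, ← mul_assoc, h.mul_crossing_mul_cup hφ, smul_mul_assoc,
      ih (h.killsCup_mul_cup hφ), smul_smul, ← mul_assoc φ]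
    congr 1
    have e1 : -((j + 1 : ℕ) * (2 * k + (j + 1 : ℕ) + 2) : ℤ) =
        -(j * (2 * k + j + 2)) + -(2 * (k + j : ℕ) + 3) := by push_cast; ring
    rw [e1, qPow_add]
    ring

/-- Turnbacks slide through the crossing, so that it exchanges the clasps on the two cables. -/
theorem killsCup_mul_crossing {n : ℕ} {φ : R} (hφ : KillsCup cup n n φ) :
    KillsCup cup n n (φ * X n n) := by
  intro i hi hi'
  rw [← h.turn_mul_cup_succ, ← mul_assoc, mul_assoc φ]
  rcases lt_or_gt_of_ne hi with hlt | hgt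
  · rw [(h.crossing_semiconjBy_upper n (show i + 2 ≤ n by omega)).eq, turn, ← mul_assoc,
      ← mul_assoc, hφ (n + i) (by omega) (by omega), zero_mul, zero_mul, zero_mul]
  · obtain ⟨k, rfl⟩ := Nat.exists_eq_add_of_le (show n ≤ i by omega)
    rw [(h.crossing_semiconjBy_lower n (show k + 2 ≤ n by omega)).eq, turn, ← mul_assoc,
      ← mul_assoc, hφ k (by omega) (by omega), zero_mul, zero_mul, zero_mul]

end CupCapRelations

end

variable {R : Type*} [Ring R]

/-! ### The coefficients -/

theorem nestedCupElt_mul_nestedCupElt (cup : ℕ → R) (k i j : ℕ) :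
    nestedCupElt cup (k + i) j * nestedCupElt cup k i = nestedCupElt cup k (i + j) := by
  induction j with
  | zero => rw [nestedCupElt, one_mul, add_zero]
  | succ j ih => rw [nestedCupElt, mul_assoc, ih, ← add_assoc, nestedCupElt, add_assoc]

theorem nestedCapElt_mul_nestedCapElt (cap : ℕ → R) (k i j : ℕ) :
    nestedCapElt cap k i * nestedCapElt cap (k + i) j = nestedCapElt cap k (i + j) := by
  induction j with
  | zero => rw [nestedCapElt, mul_one, add_zero]
  | succ j ih => rw [nestedCapElt, ← mul_assoc, ih, ← add_assoc, nestedCapElt, add_assoc]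

variable [Algebra CoeffField R]

/-- The coefficient in the formula for `m` half twists, for the final index `l = k_m`, the sums
`S = ∑ k_i` and `T = ∑ (k_i² + k_i)`, and the list `ns` of lower indices of the multinomial. -/
def twistCoeff (n m l S : ℕ) (T : ℤ) (ns : List ℕ) : CoeffField :=
  ((-1) ^ (m * n) * qPow (-((m : ℤ) * ((n : ℤ) ^ 2 + 2 * (n : ℤ))))) *
    ((-1) ^ (n - l) * qPow (2 * ((n : ℤ) - (l : ℤ))) * (-1) ^ S * qPow (2 * T) *
      qMultinomial n ns)

theorem twistCoeff_zero (n : ℕ) : twistCoeff n 0 n 0 0 [n] = 1 := by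
  simp [twistCoeff, qPow_zero, qMultinomial, div_self (qPochhammer_ne_zero n)]

theorem gaussBinom_mul_qMultinomial (u k : ℕ) (ns : List ℕ) :
    gaussBinom (k + u) u * qMultinomial k ns = qMultinomial (k + u) (u :: ns) := by
  have h := gaussBinom_mul u k
  have h1 := qPochhammer_ne_zero u
  have h2 := qPochhammer_ne_zero k
  rw [add_comm u k] at h
  rw [qMultinomial, qMultinomial, ← h, List.map_cons, List.prod_cons]
  field_simp

/-- Splitting off the first index `k = k₁` of a chain: the factors are the coefficient in the expansion
of one half twist, and the contribution of `n - k` turnbacks next to the other `m` half twists. -/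
theorem twistCoeff_succ {n k l : ℕ} (m S : ℕ) (T : ℤ) (ns : List ℕ) (hk : k ≤ n) (hl : l ≤ k) :
    twistCoeff n (m + 1) l (k + S) ((k : ℤ) ^ 2 + k + T) ((n - k) :: ns) =
      qPow (n * n + 2 * (n - k : ℕ) * ((n - k : ℕ) - 2 * n)) * gaussBinom n (n - k) *
        ((-1) ^ (n - k) * qPow (-((n - k : ℕ) * (2 * k + (n - k : ℕ) + 2)))) ^ m *
        twistCoeff k m l S T ns := by
  obtain ⟨u, rfl⟩ := Nat.exists_eq_add_of_le hk
  obtain ⟨w, rfl⟩ := Nat.exists_eq_add_of_le hl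
  rw [Nat.add_sub_cancel_left, twistCoeff, twistCoeff, Nat.add_sub_cancel_left,
    ← gaussBinom_mul_qMultinomial, show l + w + u - l = w + u by omega, mul_pow, qPow_pow, ← pow_mul]
  have hs : (-1 : CoeffField) ^ ((m + 1) * (l + w + u)) * (-1) ^ (w + u) * (-1) ^ (l + w + S) =
      (-1) ^ (u * m) * (-1) ^ (m * (l + w)) * (-1) ^ w * (-1) ^ S := by
    simp only [← pow_add]
    rw [show (m + 1) * (l + w + u) + (w + u) + (l + w + S) =
      (u * m + m * (l + w) + w + S) + 2 * (l + w + u) by ring, pow_add _ _ (2 * _), pow_mul,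
      neg_one_sq, one_pow, mul_one]
  have hq : qPow (-(((m + 1 : ℕ) : ℤ) * (((l + w + u : ℕ) : ℤ) ^ 2 + 2 * ((l + w + u : ℕ) : ℤ)))) *
      qPow (2 * (((l + w + u : ℕ) : ℤ) - (l : ℤ))) *
      qPow (2 * (((l + w : ℕ) : ℤ) ^ 2 + ((l + w : ℕ) : ℤ) + T)) =
      qPow ((l + w + u : ℕ) * (l + w + u : ℕ) + 2 * (u : ℕ) * ((u : ℕ) - 2 * (l + w + u : ℕ))) *
      qPow (-((u : ℕ) * (2 * (l + w : ℕ) + (u : ℕ) + 2)) * m) *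
      qPow (-((m : ℤ) * (((l + w : ℕ) : ℤ) ^ 2 + 2 * ((l + w : ℕ) : ℤ)))) *
      qPow (2 * (((l + w : ℕ) : ℤ) - (l : ℤ))) * qPow (2 * T) := by
    simp only [← qPow_add]
    congr 1; push_cast; ring
  linear_combination
    gaussBinom (l + w + u) u * qMultinomial (l + w) ns *
      (qPow (-(((m + 1 : ℕ) : ℤ) * (((l + w + u : ℕ) : ℤ) ^ 2 + 2 * ((l + w + u : ℕ) : ℤ)))) *
      qPow (2 * (((l + w + u : ℕ) : ℤ) - (l : ℤ))) *
      qPow (2 * (((l + w : ℕ) : ℤ) ^ 2 + ((l + w : ℕ) : ℤ) + T))) * hs +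
    gaussBinom (l + w + u) u * qMultinomial (l + w) ns *
      ((-1) ^ (u * m) * (-1) ^ (m * (l + w)) * (-1) ^ w * (-1) ^ S) * hq

/-- The chains `n = k₀ ≥ k₁ ≥ ⋯ ≥ k_m`. The entries are bounded by a fixed number `N`, which stays the
same when the first entry of a chain is removed. -/
def chains (N m n : ℕ) : Finset (Fin (m + 1) → Fin (N + 1)) :=
  {k | (k 0 : ℕ) = n ∧ ∀ i : Fin m, k i.succ ≤ k i.castSucc}

theorem last_le_of_mem_chains {N m n : ℕ} {k : Fin (m + 1) → Fin (N + 1)} (hk : k ∈ chains N m n) :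
    (k (Fin.last m) : ℕ) ≤ n := by
  simp only [chains, Finset.mem_filter_univ] at hk
  have : Antitone k := Fin.antitone_iff_succ_le.2 hk.2
  rw [← hk.1]
  exact this (Fin.zero_le _)

theorem sum_chains_zero {M : Type*} [AddCommMonoid M] {N n : ℕ} (hn : n ≤ N)
    (f : (Fin 1 → Fin (N + 1)) → M) :
    ∑ k ∈ chains N 0 n, f k = f fun _ => ⟨n, Nat.lt_succ_of_le hn⟩ := by
  have : chains N 0 n = {fun _ => ⟨n, Nat.lt_succ_of_le hn⟩} := by
    ext k
    simp only [chains, Finset.mem_filter_univ, Finset.mem_singleton]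
    constructor
    · rintro ⟨h, -⟩
      funext i
      obtain rfl : i = 0 := Fin.fin_one_eq_zero i
      exact Fin.ext h
    · rintro rfl
      exact ⟨rfl, fun i => i.elim0⟩
  rw [this, Finset.sum_singleton]

theorem sum_chains_succ {M : Type*} [AddCommMonoid M] {N n : ℕ} (hn : n ≤ N) (m : ℕ)
    (f : (Fin (m + 2) → Fin (N + 1)) → M) :
    ∑ k ∈ chains N (m + 1) n, f k = ∑ j ∈ Finset.range (n + 1), ∑ k ∈ chains N m j,
      f (Fin.cons ⟨n, Nat.lt_succ_of_le hn⟩ k) := by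
  have hmaps : ∀ k ∈ chains N (m + 1) n, (k 1 : ℕ) ∈ Finset.range (n + 1) := by
    intro k hk
    simp only [chains, Finset.mem_filter_univ] at hk
    have := hk.2 0
    rw [Finset.mem_range, Nat.lt_succ_iff, ← hk.1]
    exact this
  rw [← Finset.sum_fiberwise_of_maps_to hmaps]
  refine Finset.sum_congr rfl fun j hj => ?_
  rw [Finset.mem_range] at hj
  refine Finset.sum_bij' (fun k _ => Fin.tail k)
    (fun k _ => Fin.cons ⟨n, Nat.lt_succ_of_le hn⟩ k) ?_ ?_ ?_ ?_ ?_
  · intro k hk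
    simp only [chains, Finset.mem_filter, Finset.mem_univ, true_and] at hk ⊢
    exact ⟨hk.2, fun i => hk.1.2 i.succ⟩
  · intro k hk
    simp only [chains, Finset.mem_filter, Finset.mem_univ, true_and] at hk ⊢
    refine ⟨⟨rfl, fun i => ?_⟩, hk.1⟩
    refine Fin.cases ?_ (fun i => ?_) i
    · have : (k 0 : ℕ) ≤ n := by omega
      exact this
    · exact hk.2 i
  · intro k hk
    simp only [chains, Finset.mem_filter, Finset.mem_univ, true_and] at hk
    have : (⟨n, Nat.lt_succ_of_le hn⟩ : Fin (N + 1)) = k 0 := Fin.ext hk.1.1.symm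
    rw [this]
    exact Fin.cons_self_tail k
  · intro k _
    exact Fin.tail_cons _ _
  · intro k hk
    simp only [chains, Finset.mem_filter, Finset.mem_univ, true_and] at hk
    have : (⟨n, Nat.lt_succ_of_le hn⟩ : Fin (N + 1)) = k 0 := Fin.ext hk.1.1.symm
    rw [this, Fin.cons_self_tail]

/-- The coefficient in the formula for `m` half twists that belongs to a chain. -/
def chainCoeff {N m : ℕ} (n : ℕ) (k : Fin (m + 1) → Fin (N + 1)) : CoeffField :=
  twistCoeff n m (k (Fin.last m)) (∑ i : Fin m, (k i.succ : ℕ))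
    (∑ i : Fin m, (((k i.succ : ℕ) : ℤ) ^ 2 + ((k i.succ : ℕ) : ℤ)))
    (List.ofFn (fun i : Fin m => (k i.castSucc : ℕ) - (k i.succ : ℕ)) ++ [(k (Fin.last m) : ℕ)])

theorem chainCoeff_cons {N m n j : ℕ} (hn : n < N + 1) (hj : j ≤ n)
    {k : Fin (m + 1) → Fin (N + 1)} (hk : k ∈ chains N m j) :
    chainCoeff n (Fin.cons ⟨n, hn⟩ k : Fin (m + 2) → Fin (N + 1)) =
      qPow (n * n + 2 * (n - j : ℕ) * ((n - j : ℕ) - 2 * n)) * gaussBinom n (n - j) *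
        ((-1) ^ (n - j) * qPow (-((n - j : ℕ) * (2 * j + (n - j : ℕ) + 2)))) ^ m *
        chainCoeff j k := by
  have hl := last_le_of_mem_chains hk
  simp only [chains, Finset.mem_filter_univ] at hk
  rw [chainCoeff, chainCoeff, ← twistCoeff_succ m _ _ _ hj hl]
  have e1 : (Fin.cons ⟨n, hn⟩ k : Fin (m + 2) → Fin (N + 1)) (Fin.last (m + 1)) =
      k (Fin.last m) := rfl
  rw [e1, Fin.sum_univ_succ, Fin.sum_univ_succ, List.ofFn_succ]
  simp only [Fin.cons_succ, ← Fin.succ_castSucc, Fin.castSucc_zero, Fin.cons_zero, hk.1,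
    List.cons_append]

/-! ### Several half twists -/

namespace CupCapRelations

variable {cup cap : ℕ → R} (h : CupCapRelations cup cap)
include h

local notation "X" => crossing cup cap

theorem killsCup_mul_nestedCupElt {k j : ℕ} {φ : R} (hφ : KillsCup cup (k + j) (k + j) φ) :
    KillsCup cup k k (φ * nestedCupElt cup k j) := by
  induction j generalizing φ with
  | zero => rwa [nestedCupElt, mul_one]
  | succ j ih =>
    rw [nestedCupElt, ← mul_assoc]
    exact ih (h.killsCup_mul_cup hφ)

theorem capKilled_nestedCapElt_mul {k j : ℕ} {v : R} (hv : CapKilled cap (k + j) (k + j) v) :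
    CapKilled cap k k (nestedCapElt cap k j * v) := by
  induction j generalizing v with
  | zero => rwa [nestedCapElt, one_mul]
  | succ j ih =>
    rw [nestedCapElt, mul_assoc]
    exact ih (h.capKilled_cap_mul hv)

theorem killsCup_mul_crossing_pow {n : ℕ} {φ : R} (hφ : KillsCup cup n n φ) (m : ℕ) :
    KillsCup cup n n (φ * X n n ^ m) := by
  induction m with
  | zero => rwa [pow_zero, mul_one]
  | succ m ih => rw [pow_succ, ← mul_assoc]; exact h.killsCup_mul_crossing ih

theorem mul_crossing_pow_mul_nestedCupElt {k j : ℕ} {φ : R}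
    (hφ : KillsCup cup (k + j) (k + j) φ) (m : ℕ) :
    φ * X (k + j) (k + j) ^ m * nestedCupElt cup k j =
      ((-1) ^ j * qPow (-(j * (2 * k + j + 2)))) ^ m •
        (φ * nestedCupElt cup k j * X k k ^ m) := by
  induction m generalizing φ with
  | zero => simp
  | succ m ih =>
    rw [pow_succ', ← mul_assoc, ih (h.killsCup_mul_crossing hφ),
      h.mul_crossing_mul_nestedCupElt hφ, smul_mul_assoc, smul_smul, ← pow_succ, mul_assoc,
      ← pow_succ']

/-- The formula for `m` half twists, with arbitrary elements that are killed by the same caps and cups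
as clasps in place of the clasps. -/
theorem mul_crossing_pow_mul {N n : ℕ} (hn : n ≤ N) (m : ℕ) {φ v : R} (hφ : KillsCup cup n n φ)
    (hv : CapKilled cap n n v) :
    φ * X n n ^ m * v = ∑ k ∈ chains N m n, chainCoeff n k •
      (φ * nestedCupElt cup (k (Fin.last m)) (n - k (Fin.last m)) *
        nestedCapElt cap (k (Fin.last m)) (n - k (Fin.last m)) * v) := by
  induction m generalizing n φ v with
  | zero =>
    rw [sum_chains_zero hn]
    simp [chainCoeff, nestedCupElt, nestedCapElt, twistCoeff_zero]
  | succ m ih =>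
    -- The first half twist is expanded, and the others are moved past the turnbacks.
    rw [sum_chains_succ hn, pow_succ, ← mul_assoc,
      h.mul_crossing_mul_eq_sum (h.killsCup_mul_crossing_pow hφ m) hv le_rfl le_rfl,
      ← Finset.sum_range_reflect]
    refine Finset.sum_congr rfl fun j hj => ?_
    have hj : j ≤ n := by rw [Finset.mem_range] at hj; omega
    obtain ⟨u, rfl⟩ := Nat.exists_eq_add_of_le hj
    have e1 : j + u + 1 - 1 - j = u := by omega
    have e2 : j + u - u = j := by omega
    rw [e1, e2, h.mul_crossing_pow_mul_nestedCupElt hφ, smul_mul_assoc, smul_mul_assoc, smul_smul,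
      mul_assoc _ (nestedCapElt cap j u),
      ih (by omega) (h.killsCup_mul_nestedCupElt hφ) (h.capKilled_nestedCapElt_mul hv),
      Finset.smul_sum]
    refine Finset.sum_congr rfl fun k hk => ?_
    rw [smul_smul, chainCoeff_cons (by omega) hj hk, Nat.add_sub_cancel_left]
    congr 1
    have hl := last_le_of_mem_chains hk
    have e3 : (Fin.cons ⟨j + u, by omega⟩ k : Fin (m + 2) → Fin (N + 1)) (Fin.last (m + 1)) =
      k (Fin.last m) := rfl
    rw [e3]
    obtain ⟨w, hw⟩ := Nat.exists_eq_add_of_le hl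
    generalize (k (Fin.last m) : ℕ) = l at hw
    subst hw
    rw [Nat.add_sub_cancel_left, show l + w + u - l = w + u by omega,
      ← nestedCupElt_mul_nestedCupElt, ← nestedCapElt_mul_nestedCapElt]
    simp only [mul_assoc]

end CupCapRelations

/-! ### Evaluation of tangle diagrams -/

namespace TangleDiagram

/-- The product of the operators that belong to the features of a tangle diagram. -/
def eval (cup cap : ℕ → R) {a : ℕ} : {b : ℕ} → TangleDiagram a b → R
  | _, .strands => 1
  | _, .cup i _ _ D => cup i * D.eval cup cap
  | _, .cap i _ _ D => cap i * D.eval cup cap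
  | _, .over i _ D => crossOver cup cap i * D.eval cup cap
  | _, .under i _ D => crossUnder cup cap i * D.eval cup cap
  | _, .clasp i n _ D => claspElt cup cap i n * D.eval cup cap

variable (cup cap : ℕ → R) {a : ℕ}

theorem eval_cast {b b' : ℕ} (h : b = b') (D : TangleDiagram a b) :
    (D.cast h).eval cup cap = D.eval cup cap := by
  subst h; rfl

theorem eval_passUnder {b : ℕ} (i c : ℕ) (h : i + c < b) (D : TangleDiagram a b) :
    (D.passUnder i c h).eval cup cap = ascProd (crossOver cup cap) i c * D.eval cup cap := by
  induction c generalizing D with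
  | zero => rw [passUnder, ascProd, one_mul]
  | succ c ih => rw [passUnder, ih, eval, ascProd, mul_assoc]

theorem eval_cableCrossing {b : ℕ} (c d : ℕ) (h : 0 + c + d ≤ b) (D : TangleDiagram a b) :
    (D.cableCrossing 0 c d h).eval cup cap = crossing cup cap c d * D.eval cup cap := by
  induction d with
  | zero => rw [cableCrossing, crossing, one_mul]
  | succ d ih => rw [cableCrossing, eval_passUnder, ih (by omega), crossing, zero_add, mul_assoc]

theorem eval_halfTwist_iterate (n m : ℕ) (D : TangleDiagram a (2 * n)) :
    ((halfTwist n)^[m] D).eval cup cap = crossing cup cap n n ^ m * D.eval cup cap := by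
  induction m with
  | zero => simp
  | succ m ih =>
    rw [Function.iterate_succ_apply', halfTwist, eval_cableCrossing, ih, pow_succ', mul_assoc]

theorem eval_nestedCaps (k j : ℕ) (D : TangleDiagram a (2 * (k + j))) :
    (nestedCaps k j D).eval cup cap = nestedCapElt cap k j * D.eval cup cap := by
  induction j with
  | zero => rw [nestedCaps, nestedCapElt, one_mul]
  | succ j ih => rw [nestedCaps, ih, eval, nestedCapElt, mul_assoc]

theorem eval_nestedCups (k j : ℕ) (D : TangleDiagram a (2 * k)) :
    (nestedCups k j D).eval cup cap = nestedCupElt cup k j * D.eval cup cap := by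
  induction j with
  | zero => rw [nestedCups, nestedCupElt, one_mul]
  | succ j ih => rw [nestedCups, eval, ih, nestedCupElt, mul_assoc]

theorem eval_twoClasps (n : ℕ) (D : TangleDiagram a (2 * n)) :
    (twoClasps n D).eval cup cap =
      claspElt cup cap n n * claspElt cup cap 0 n * D.eval cup cap := by
  rw [twoClasps, eval, eval, mul_assoc]

theorem eval_claspedTwist (n m : ℕ) : (claspedTwist n m).eval cup cap =
    (claspElt cup cap n n * claspElt cup cap 0 n) * crossing cup cap n n ^ m *
      (claspElt cup cap n n * claspElt cup cap 0 n) := by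
  rw [claspedTwist, eval_twoClasps, eval_halfTwist_iterate, eval_twoClasps, eval, mul_one]
  simp only [mul_assoc]

theorem eval_claspedWeb (n k : ℕ) (hk : k ≤ n) : (claspedWeb n k hk).eval cup cap =
    (claspElt cup cap n n * claspElt cup cap 0 n) * nestedCupElt cup k (n - k) *
      nestedCapElt cap k (n - k) * (claspElt cup cap n n * claspElt cup cap 0 n) := by
  rw [claspedWeb, eval_twoClasps, eval_cast, eval_nestedCups, eval_nestedCaps, eval_cast,
    eval_twoClasps, eval, mul_one]
  simp only [mul_assoc]

end TangleDiagram

theorem toOpen_turnMap {m : ℕ} (i : ℕ) (hi : i + 1 < m) (v : WebSpace m) :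
    toOpen m (turnMap i hi v) = turn openCup openCap i (toOpen m v) := by
  rw [turnMap, LinearMap.comp_apply, toOpen_cupMap, toOpen_capMap]; rfl

theorem toOpen_claspMap {m : ℕ} (i n : ℕ) (hi : i + n ≤ m) (v : WebSpace m) :
    toOpen m (claspMap i n hi v) = claspElt openCup openCap i n (toOpen m v) := by
  match n, hi with
  | 0, _ => rfl
  | 1, _ => rfl
  | n + 2, hi =>
    have ih := fun v : WebSpace m => toOpen_claspMap i (n + 1) (by omega) v
    simp only [claspMap, claspElt, LinearMap.add_apply, LinearMap.smul_apply, LinearMap.comp_apply,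
      map_add, map_smul, ih, toOpen_turnMap, Module.End.mul_apply]

theorem claspElt_shift (cup cap : ℕ → R) (a i n : ℕ) :
    claspElt (fun i => cup (a + i)) (fun i => cap (a + i)) i n = claspElt cup cap (a + i) n := by
  match n with
  | 0 => rfl
  | 1 => rfl
  | n + 2 => simp only [claspElt, claspElt_shift cup cap a i (n + 1), turn, add_assoc]

/-- The bracket in terms of operators. The right ends of a diagram with `a` left ends are the marked
points from `a` on, hence the shift. -/
theorem toOpen_bracket {a : ℕ} : ∀ {b : ℕ} (D : TangleDiagram a b), toOpen (a + b) D.bracket =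
    D.eval (fun i => openCup (a + i)) (fun i => openCap (a + i))
      (toOpen (a + a) (Finsupp.single (BasisWeb.nested a) 1))
  | _, .strands => rfl
  | _, .cup i hb hi D => by
    rw [TangleDiagram.bracket, toOpen_cupMap, toOpen_bracket D, TangleDiagram.eval,
      Module.End.mul_apply]
  | _, .cap i hb hi D => by
    rw [TangleDiagram.bracket, toOpen_capMap, toOpen_bracket D, TangleDiagram.eval,
      Module.End.mul_apply]
  | _, .over i hi D => by
    rw [TangleDiagram.bracket, map_add, map_smul, map_smul, toOpen_turnMap, toOpen_bracket D,
      TangleDiagram.eval, Module.End.mul_apply]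
    rfl
  | _, .under i hi D => by
    rw [TangleDiagram.bracket, map_add, map_smul, map_smul, toOpen_turnMap, toOpen_bracket D,
      TangleDiagram.eval, Module.End.mul_apply]
    rfl
  | _, .clasp i n hi D => by
    rw [TangleDiagram.bracket, toOpen_claspMap, toOpen_bracket D, TangleDiagram.eval,
      Module.End.mul_apply, claspElt_shift]

namespace CupCapRelations

variable {cup cap : ℕ → R} (h : CupCapRelations cup cap)
include h

local notation "P" => claspElt cup cap

theorem killsCup_clasps (n : ℕ) : KillsCup cup n n (P n n * P 0 n) := by
  intro i hi hi'
  rcases lt_or_gt_of_ne hi with hlt | hgt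
  · rw [mul_assoc, ← zero_add i, h.claspElt_mul_cup hlt, mul_zero]
  · obtain ⟨j, rfl⟩ := Nat.exists_eq_add_of_le (show n ≤ i by omega)
    rw [(h.commute_claspElt_claspElt n).eq, mul_assoc, h.claspElt_mul_cup (by omega), mul_zero]

theorem capKilled_clasps (n : ℕ) : CapKilled cap n n (P n n * P 0 n) := by
  intro i hi hi'
  rcases lt_or_gt_of_ne hi with hlt | hgt
  · rw [(h.commute_claspElt_claspElt n).eq, ← mul_assoc, ← zero_add i, h.cap_mul_claspElt hlt,
      zero_mul]
  · obtain ⟨j, rfl⟩ := Nat.exists_eq_add_of_le (show n ≤ i by omega)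
    rw [← mul_assoc, h.cap_mul_claspElt (by omega), zero_mul]

end CupCapRelations

end

end KauffmanSkein

theorem mainTheorem7 (n m : ℕ) :
    (KauffmanSkein.TangleDiagram.claspedTwist n m).bracket =
      ((-1) ^ (m * n) * KauffmanSkein.qPow (-((m : ℤ) * ((n : ℤ) ^ 2 + 2 * (n : ℤ))))) •
        ∑ k : Fin (m + 1) → Fin (n + 1) with
            k 0 = Fin.last n ∧ ∀ i : Fin m, k i.succ ≤ k i.castSucc,
          ((-1) ^ (n - (k (Fin.last m) : ℕ)) *
              KauffmanSkein.qPow (2 * ((n : ℤ) - ((k (Fin.last m) : ℕ) : ℤ))) *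
              (-1) ^ (∑ i : Fin m, (k i.succ : ℕ)) *
              KauffmanSkein.qPow
                (2 * ∑ i : Fin m, (((k i.succ : ℕ) : ℤ) ^ 2 + ((k i.succ : ℕ) : ℤ))) *
              KauffmanSkein.qMultinomial n
                (List.ofFn (fun i : Fin m => (k i.castSucc : ℕ) - (k i.succ : ℕ)) ++
                  [(k (Fin.last m) : ℕ)])) •
            (KauffmanSkein.TangleDiagram.claspedWeb n (k (Fin.last m) : ℕ)
              (Nat.le_of_lt_succ (k (Fin.last m)).isLt)).bracket := by
  apply KauffmanSkein.toOpen_injective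
  have h := KauffmanSkein.openWeb_relations.shift (2 * n)
  rw [map_smul, map_sum, KauffmanSkein.toOpen_bracket,
    KauffmanSkein.TangleDiagram.eval_claspedTwist,
    h.mul_crossing_pow_mul le_rfl m (h.killsCup_clasps n) (h.capKilled_clasps n),
    LinearMap.sum_apply, Finset.smul_sum]
  refine Finset.sum_congr ?_ fun k _ => ?_
  · ext k
    simp [KauffmanSkein.chains, Fin.ext_iff]
  · rw [map_smul, KauffmanSkein.toOpen_bracket, KauffmanSkein.TangleDiagram.eval_claspedWeb,
      smul_smul, LinearMap.smul_apply]
    rfl
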